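/- Let $A$ be an artin algebra (a ring that is a finitely generated module over a commutative artinian ring acting centrally), with Jacobson radical $J=J(A)$, and let $M$ be a finitely generated semilocal right $A$-module, i.e. a direct sum of modules with simple top. Let $m=\ell\ell(M)$ be its Loewy length (the least $n$ with $MJ^n=0$) and let $\widetilde M=\bigoplus_{X\in\mathsf F}X$ be the basic module of $\bigoplus_{i=1}^m M/MJ^i$, where $\mathsf F$ is a complete set of representatives of the isomorphism classes of indecomposable direct summands of $\bigoplus_{i=1}^m M/MJ^i$. Let $B=\operatorname{End}_A(\widetilde M)$ be the ADR algebra of $M$, whose product is composition of maps $(b\cdot b')(x)=b(b'(x))$. For $0\le i\le m-1$ let $\mathsf F_i=\{X\in\mathsf F:\ell\ell(X)=m-i\}$, and for $j\ge 1$ define inductively $\mathsf F_{i,j}$ to be the set of all $X\in \mathsf F_i\setminus\bigcup_{1\le k<j}\mathsf F_{i,k}$ such that for no $N\in \mathsf F_i\setminus\bigcup_{1\le k<j}\mathsf F_{i,k}$ is there a surjective homomorphism $f:X\to N$ in the radical of the module category (that is, such that $1-gf$ is invertible for all $g:N\to X$). The ADR order is the partial order on $\mathsf F$ in which $X<Y$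 if and only if $X\in\mathsf F_{i,j}$ and $Y\in\mathsf F_{i',j'}$ with $(i,j)$ lexicographically smaller than $(i',j')$. For $X\in\mathsf F$ put $S(X)=\operatorname{top}\operatorname{Hom}_A(\widetilde M,X)$, a right $B$-module. Then $B$ is an artin algebra, $\{S(X):X\in\mathsf F\}$ is a complete set of representatives of the isomorphism classes of simple right $B$-modules, and $B$ is left-strongly quasi-hereditary with respect to the ADR order. That is, let $E(X)$ be the injective hull of $S(X)$ and $\nabla(X)$ the largest submodule of $E(X)$ all of whose composition factors are of the form $S(Y)$ with $Y\le X$. Then for every $X\in\mathsf F$: (a) $E(X)/\nabla(X)$ has a finite filtration whose factors are isomorphic to modules $\nabla(Y)$, $Y\in\mathsf F$; (b) if $\nabla(Y)$ occurs as a factor of such a filtration of $E(X)/\nabla(X)$, then $X<Y$; (c) $E(X)/\nabla(X)$ is an injective $B$-module. -/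

import Mathlib

universe u v w z

namespace ADR

/-- An artin algebra: a ring that is a finitely generated module over some commutative artinian
ring `k` acting centrally. (Replacing `k` by its image in `R`, one may take `k` in the universe
of `R`.) -/
def IsArtinAlgebra (R : Type u) [Ring R] : Prop :=
  ∃ (k : Type u) (_ : CommRing k) (_ : Algebra k R), IsArtinianRing k ∧ Module.Finite k R

/-! ### Modules over a ring `R`

Right modules over a ring `A` are modules over `R = Aᵐᵒᵖ`; the Jacobson radical of `Aᵐᵒᵖ` is
the Jacobson radical of `A`. -/

section Modules

variable (R : Type u) [Ring R]

/-- The submodule `J(R)^n N` of `N`; for `R = Aᵐᵒᵖ` this is `N J(A)^n`. -/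
def radPow (N : Type v) [AddCommGroup N] [Module R N] : ℕ → Submodule R N
  | 0 => ⊤
  | n + 1 => Ring.jacobson R • radPow N n

/-- The Loewy length: the least `n` with `J(R)^n N = 0`. -/
noncomputable def loewyLength (N : Type v) [AddCommGroup N] [Module R N] : ℕ :=
  sInf {n | radPow R N n = ⊥}

/-- A local module: one with simple top. -/
def IsLocalModule (N : Type v) [AddCommGroup N] [Module R N] : Prop :=
  IsSimpleModule R (N ⧸ Module.jacobson R N)

/-- A semilocal module: a direct sum of local modules. -/
def IsSemilocalModule (N : Type v) [AddCommGroup N] [Module R N] : Prop :=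
  ∃ (κ : Type v) (L : κ → Submodule R N),
    iSupIndep L ∧ ⨆ a, L a = ⊤ ∧ ∀ a, IsLocalModule R (L a)

/-- An indecomposable module. -/
def IsIndecomposableModule (N : Type v) [AddCommGroup N] [Module R N] : Prop :=
  Nontrivial N ∧ ∀ P Q : Submodule R N, IsCompl P Q → P = ⊥ ∨ Q = ⊥

/-- `⊕_{i=1}^{m} N / N J^i` where `m` is the Loewy length of `N`. -/
abbrev LoewySum (N : Type v) [AddCommGroup N] [Module R N] : Type v :=
  ∀ i : Fin (loewyLength R N), N ⧸ radPow R N ((i : ℕ) + 1)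

/-- `T = ⊕ X a` is the basic module of `N`: the `X a` are indecomposable and pairwise
non-isomorphic, and up to isomorphism they are precisely the indecomposable direct summands
of `N`. -/
structure IsBasicModuleOf (N : Type v) [AddCommGroup N] [Module R N]
    {T : Type w} [AddCommGroup T] [Module R T] {ι : Type z} (X : ι → Submodule R T) : Prop where
  indep : iSupIndep X
  iSup_eq_top : ⨆ a, X a = ⊤
  indecomposable : ∀ a, IsIndecomposableModule R (X a)
  not_iso : ∀ a b, Nonempty (X a ≃ₗ[R] X b) → a = b
  summand : ∀ a, ∃ Y Z : Submodule R N, IsCompl Y Z ∧ Nonempty (X a ≃ₗ[R] Y)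
  complete : ∀ Y Z : Submodule R N, IsCompl Y Z → IsIndecomposableModule R Y →
    ∃ a, Nonempty (X a ≃ₗ[R] Y)

variable {R}

/-- The (Jacobson) radical of the category of modules: `f : X → Y` is a radical map if `1 - g f`
is invertible for every `g : Y → X`. -/
def IsRadicalMap {X : Type v} {Y : Type w} [AddCommGroup X] [Module R X]
    [AddCommGroup Y] [Module R Y] (f : X →ₗ[R] Y) : Prop :=
  ∀ g : Y →ₗ[R] X, IsUnit (1 - g ∘ₗ f : Module.End R X)

/-- `f : S → E` is an injective hull of `S`: `E` is injective and `f` is an essential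
monomorphism. -/
def IsInjectiveHull {S E : Type v} [AddCommGroup S] [Module R S]
    [AddCommGroup E] [Module R E] (f : S →ₗ[R] E) : Prop :=
  Module.Injective R E ∧ Function.Injective f ∧
    ∀ L : Submodule R E, L ⊓ LinearMap.range f = ⊥ → L = ⊥

/-- The submodules `N'` of `E` all of whose composition factors `L₁ / L₀` (with `L₀ ⋖ L₁ ≤ N'`)
are isomorphic to `S j` for some `j` with `p j`. -/
def HasFactorsIn {I : Type z} (S : I → ModuleCat.{v} R) (p : I → Prop)
    {E : Type v} [AddCommGroup E] [Module R E] (N' : Submodule R E) : Prop :=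
  ∀ L₀ L₁ : Submodule R E, L₀ ⋖ L₁ → L₁ ≤ N' →
    ∃ j, p j ∧ Nonempty ((L₁ ⧸ L₀.submoduleOf L₁) ≃ₗ[R] S j)

/-- The costandard module `∇(i)`: the largest submodule of the injective hull `E` of `S i` whose
composition factors are of the form `S j` with `j ≤ i`. -/
def nabla {I : Type z} (ord : PartialOrder I) (S : I → ModuleCat.{v} R)
    (E : I → ModuleCat.{v} R) (i : I) : Submodule R (E i) :=
  sSup {N' | HasFactorsIn S (fun j => ord.le j i) N'}

/-- A finite filtration `N = N_0 ⊇ N_1 ⊇ ⋯ ⊇ N_l = 0` with `N_a / N_{a+1}` isomorphic to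
`V (label a)`. -/
structure Filtration {I : Type z} (V : I → ModuleCat.{v} R)
    (N : Type v) [AddCommGroup N] [Module R N] where
  length : ℕ
  sub : Fin (length + 1) → Submodule R N
  label : Fin length → I
  sub_zero : sub 0 = ⊤
  sub_last : sub (Fin.last length) = ⊥
  le : ∀ a : Fin length, sub a.succ ≤ sub a.castSucc
  iso : ∀ a : Fin length,
    Nonempty ((sub a.castSucc ⧸ (sub a.succ).submoduleOf (sub a.castSucc)) ≃ₗ[R] V (label a))

/-- The multiplicity of `V j` in a filtration. -/
noncomputable def Filtration.mult {I : Type z} {V : I → ModuleCat.{v} R}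
    {N : Type v} [AddCommGroup N] [Module R N] (F : Filtration V N) (j : I) : ℕ :=
  Nat.card {a : Fin F.length // F.label a = j}

/-- `S` is a complete set of representatives of the isomorphism classes of simple modules. -/
structure IsCompleteSetOfSimples {I : Type z} (S : I → ModuleCat.{u} R) : Prop where
  simple : ∀ i, IsSimpleModule R (S i)
  not_iso : ∀ i j, Nonempty (S i ≃ₗ[R] S j) → i = j
  complete : ∀ T : ModuleCat.{u} R, IsSimpleModule R T → ∃ i, Nonempty (S i ≃ₗ[R] T)

end Modules

/-! ### Left-strongly quasi-hereditary algebras -/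

/-- The artin algebra `B`, with the partial order `ord` on the index set of a complete set `S` of
representatives of the simple right `B`-modules, is left-strongly quasi-hereditary: with `E i`
the injective hull of `S i` (unique up to isomorphism) and `∇(i) ⊆ E i` the costandard module,
(a) `E i / ∇(i)` has a `∇`-filtration, (b) only `∇(j)` with `i < j` occur in it, and
(c) `E i / ∇(i)` is injective. -/
def IsLeftStronglyQuasiHereditary (B : Type u) [Ring B] {I : Type z} (ord : PartialOrder I)
    (S : I → ModuleCat.{u} Bᵐᵒᵖ) : Prop :=
  IsArtinAlgebra B ∧ IsCompleteSetOfSimples S ∧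
  ∃ (E : I → ModuleCat.{u} Bᵐᵒᵖ) (f : ∀ i, S i →ₗ[Bᵐᵒᵖ] E i),
    (∀ i, IsInjectiveHull (f i)) ∧
    ∀ i,
      Nonempty (Filtration (fun j => ModuleCat.of Bᵐᵒᵖ (nabla ord S E j))
        (E i ⧸ nabla ord S E i)) ∧
      (∀ F : Filtration (fun j => ModuleCat.of Bᵐᵒᵖ (nabla ord S E j)) (E i ⧸ nabla ord S E i),
        ∀ j, F.mult j ≠ 0 → ord.lt i j) ∧
      Module.Injective Bᵐᵒᵖ (E i ⧸ nabla ord S E i)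

/-! ### The layers and the ADR order -/

section Layers

variable {R : Type u} [Ring R] {T : Type w} [AddCommGroup T] [Module R T] {ι : Type z}

/-- The members `x` of `s` such that there is no surjective radical map from `X x` to any
`X y` with `y ∈ s`. -/
def noSurj (X : ι → Submodule R T) (s : Set ι) : Set ι :=
  {x ∈ s | ∀ y ∈ s, ¬ ∃ f : X x →ₗ[R] X y, IsRadicalMap f ∧ Function.Surjective f}

/-- `F_i`: the indices of the summands of Loewy length `m - i`. -/
def lengthLayer (X : ι → Submodule R T) (m i : ℕ) : Set ι :=
  {x | loewyLength R (X x) + i = m}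

/-- What is left of `F_i` after the removal of `F_{i,1}, …, F_{i,j}`. -/
def layerRest (X : ι → Submodule R T) (m i : ℕ) : ℕ → Set ι
  | 0 => lengthLayer X m i
  | j + 1 => layerRest X m i j \ noSurj X (layerRest X m i j)

/-- The layer `F_{i,j+1}` (the second index is shifted by one). -/
def layer (X : ι → Submodule R T) (m i j : ℕ) : Set ι :=
  noSurj X (layerRest X m i j)

theorem layerRest_anti (X : ι → Submodule R T) (m i : ℕ) : Antitone (layerRest X m i) :=
  antitone_nat_of_succ_le fun _ => Set.sdiff_subset

theorem not_mem_layer_of_lt (X : ι → Submodule R T) {m i j j' : ℕ} {x : ι}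
    (h : x ∈ layer X m i j) (hlt : j < j') : x ∉ layer X m i j' := fun h' =>
  (layerRest_anti X m i (Nat.succ_le_of_lt hlt) h'.1).2 h

theorem layer_unique (X : ι → Submodule R T) {m i j i' j' : ℕ} {x : ι}
    (h : x ∈ layer X m i j) (h' : x ∈ layer X m i' j') : i = i' ∧ j = j' := by
  have e : loewyLength R (X x) + i = m := layerRest_anti X m i (Nat.zero_le j) h.1
  have e' : loewyLength R (X x) + i' = m := layerRest_anti X m i' (Nat.zero_le j') h'.1
  obtain rfl : i = i' := by omega
  refine ⟨rfl, ?_⟩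
  rcases lt_trichotomy j j' with hlt | heq | hlt
  · exact absurd h' (not_mem_layer_of_lt X h hlt)
  · exact heq
  · exact absurd h (not_mem_layer_of_lt X h' hlt)

/-- `x` lies in an earlier layer than `y` in the sequence
`F_{0,1}, …, F_{0,n_0}, F_{1,1}, …, F_{m-1,n_{m-1}}`. -/
def adrLT (X : ι → Submodule R T) (m : ℕ) (x y : ι) : Prop :=
  ∃ i j i' j', x ∈ layer X m i j ∧ y ∈ layer X m i' j' ∧ (i < i' ∨ i = i' ∧ j < j')

/-- The ADR order `F_{0,1} < ⋯ < F_{0,n_0} < F_{1,1} < ⋯ < F_{m-1,n_{m-1}}`; distinct members of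
the same layer are incomparable. -/
@[reducible] def adrOrder (X : ι → Submodule R T) (m : ℕ) : PartialOrder ι where
  le x y := x = y ∨ adrLT X m x y
  lt x y := adrLT X m x y
  le_refl x := Or.inl rfl
  le_trans := by
    rintro x y t (rfl | ⟨i, j, i', j', hx, hy, h⟩) (rfl | ⟨k, l, k', l', hy', ht, h'⟩)
    · exact Or.inl rfl
    · exact Or.inr ⟨k, l, k', l', hy', ht, h'⟩
    · exact Or.inr ⟨i, j, i', j', hx, hy, h⟩
    · obtain ⟨rfl, rfl⟩ := layer_unique X hy hy'
      exact Or.inr ⟨i, j, k', l', hx, ht, by omega⟩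
  le_antisymm := by
    rintro x y (rfl | ⟨i, j, i', j', hx, hy, h⟩) (h₂ | ⟨k, l, k', l', hy', hx', h'⟩)
    · rfl
    · rfl
    · exact h₂.symm
    · obtain ⟨rfl, rfl⟩ := layer_unique X hy hy'
      obtain ⟨rfl, rfl⟩ := layer_unique X hx hx'
      omega
  lt_iff_le_not_ge := by
    intro x y
    constructor
    · rintro ⟨i, j, i', j', hx, hy, h⟩
      refine ⟨Or.inr ⟨i, j, i', j', hx, hy, h⟩, ?_⟩
      rintro (rfl | ⟨k, l, k', l', hy', hx', h'⟩)
      · obtain ⟨rfl, rfl⟩ := layer_unique X hx hy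
        omega
      · obtain ⟨rfl, rfl⟩ := layer_unique X hy hy'
        obtain ⟨rfl, rfl⟩ := layer_unique X hx hx'
        omega
    · rintro ⟨rfl | h, h'⟩
      · exact absurd (Or.inl rfl) h'
      · exact h

/-! ### The simple modules of the endomorphism algebra -/

/-- `Hom_R(T, L)` as a right module over `End_R(T)`, acting by precomposition, realised as the
right ideal of the endomorphisms of `T` with image in the submodule `L`. -/
def homInto (L : Submodule R T) :
    Submodule (Module.End R T)ᵐᵒᵖ (Module.End R T) where
  carrier := {b | ∀ x, b x ∈ L}
  add_mem' hb hc x := L.add_mem (hb x) (hc x)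
  zero_mem' _ := L.zero_mem
  smul_mem' c _ hb x := hb (c.unop x)

/-- The right `End_R(T)`-module `top Hom_R(T, L)`. -/
abbrev topHom (L : Submodule R T) : ModuleCat.{w} (Module.End R T)ᵐᵒᵖ :=
  ModuleCat.of _ (homInto L ⧸ Module.jacobson (Module.End R T)ᵐᵒᵖ (homInto L))

end Layers

end ADR

namespace ADR

/-! Write `e a` for the projection of `T` onto `X a`, so that `B e_a` is `Hom(X a, T)`. Let `D =
Hom_k(-, I)` for a minimal injective cogenerator `I` of the artinian base ring `k`. Then `E(a) = D(B
e_a)` is the injective hull of `S(a)`, and `∇(a)` consists of the functionals that vanish on the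
trace in `B e_a` of the `B e_c` with `c ≰ a`, that is, on the maps out of `X a` that factor through
such an `X c`.

The heart is `radPow_le_ker_of_not_le`. Let `n` be the Loewy length of `X a`; every map `X a → X c`
with `c ≰ a` kills `J^(n-1) X a`. If `X c` has smaller Loewy length, this is clear. Otherwise the
lengths agree and `c` lies in the same layer as `a` or a later one; then the map is not surjective,
its image lies in the radical of the local module `X c`, and one power of `J` is gained. A larger
Loewy length would give `c < a`.

Such maps therefore factor through `X a / J^(n-1) X a`, which for `n ≥ 2` is again some `X s`,
because the `X a` are the quotients `L / J^i L` of the local summands `L` of `M`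
(`IsBasicModuleOf.structure_of_isSemilocal`). Clearly `a < s`. With `p : X a → X s` the projection,
`x ↦ x p` identifies `B e_s` with the trace, and dualising gives `E(a)/∇(a) ≅ E(s)`
(`nonempty_quotient_costandard_equiv`). For `n = 1` the trace is zero and `∇(a) = E(a)`. So
`E(a)/∇(a)` is injective, and the filtration statements follow by descending induction along the
order. For an arbitrary filtration of `E(s)`, `eq_nabla_of_equiv` shows that its bottom term is
`∇(s)`. -/

/-! ### Injective hulls and a duality over a commutative ring. -/

theorem exists_isInjectiveHull {k : Type w} [Ring k] (Q : Type w) [AddCommGroup Q] [Module k Q] :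
    ∃ (I : Type w) (_ : AddCommGroup I) (_ : Module k I) (f : Q →ₗ[k] I), IsInjectiveHull f := by
  obtain ⟨⟨I₀, inj, f₀, mono⟩⟩ := CategoryTheory.EnoughInjectives.presentation (ModuleCat.of k Q)
  have hinj : Module.Injective k I₀ := (Module.injective_iff_injective_object k I₀).2 inj
  have hf₀ : Function.Injective f₀.hom := (ModuleCat.mono_iff_injective f₀).1 mono
  set Q₀ : Submodule k I₀ := LinearMap.range f₀.hom with hQ₀
  -- `E` is a maximal essential extension of `Q₀` inside `I₀`, and `C` below is maximal with `C ⊓ E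
  -- = ⊥`. The aim is that `E` is a direct summand of `I₀`.
  obtain ⟨E, -, hE⟩ := zorn_le_nonempty₀
    {L : Submodule k I₀ | Q₀ ≤ L ∧ ∀ D ≤ L, D ⊓ Q₀ = ⊥ → D = ⊥} (by
      intro c hc hchain y hy
      refine ⟨sSup c, ⟨(hc hy).1.trans (le_sSup hy), fun D hD h => ?_⟩, fun z hz => le_sSup hz⟩
      rw [eq_bot_iff]
      intro d hd
      obtain ⟨L, hL, hdL⟩ := (Submodule.mem_sSup_of_directed ⟨y, hy⟩ hchain.directedOn).1 (hD hd)
      have := (hc hL).2 (k ∙ d) (by simpa using hdL)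
        (eq_bot_iff.2 ((inf_le_inf_right _ (by simpa using hd)).trans h.le))
      simpa using this) Q₀ ⟨le_rfl, fun D hD h => by rwa [inf_eq_left.2 hD] at h⟩
  obtain ⟨C, -, hC⟩ := zorn_le_nonempty₀ {L : Submodule k I₀ | L ⊓ E = ⊥} (by
      intro c hc hchain y hy
      refine ⟨sSup c, ?_, fun z hz => le_sSup hz⟩
      change _ = _
      rw [eq_bot_iff]
      rintro d ⟨hd, hdE⟩
      obtain ⟨L, hL, hdL⟩ := (Submodule.mem_sSup_of_directed ⟨y, hy⟩ hchain.directedOn).1 hd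
      have : L ⊓ E = ⊥ := hc hL
      exact this.le ⟨hdL, hdE⟩) ⊥ (by simp)
  have hCE : C ⊓ E = ⊥ := hC.prop
  -- `E` embeds in `I₀ / C`, so its inclusion extends to `h`. The range of `h` is still essential
  -- over `Q₀`, so maximality puts it inside `E`, and `h ∘ₗ C.mkQ` is a retraction onto `E`.
  obtain ⟨h, hh⟩ := hinj.out (C.mkQ ∘ₗ E.subtype) (by
      rw [← LinearMap.ker_eq_bot, LinearMap.ker_comp, Submodule.ker_mkQ, eq_bot_iff]
      rintro ⟨x, hx⟩ hxC
      simpa using hCE.le ⟨hxC, hx⟩) E.subtype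
  have hmax : ∀ D : Submodule k I₀, C ≤ D → D ⊓ E = ⊥ → D ≤ C := fun D h₁ h₂ => hC.le_of_ge h₂ h₁
  have hrange : LinearMap.range h ≤ E := by
    refine hE.le_of_ge ⟨?_, ?_⟩ ?_
    · exact hE.prop.1.trans fun x hx => ⟨_, hh ⟨x, hx⟩⟩
    · intro D hD hDQ
      have h₁ : D ⊓ E = ⊥ := hE.prop.2 _ inf_le_right
        (eq_bot_iff.2 ((inf_le_inf_right _ inf_le_left).trans hDQ.le))
      have h₂ : D.comap (h ∘ₗ C.mkQ) ≤ C := by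
        refine hmax _ (fun x hx => ?_) (eq_bot_iff.2 ?_)
        · have : C.mkQ x = 0 := by simpa using hx
          simp only [Submodule.mem_comap, LinearMap.comp_apply, this, map_zero, D.zero_mem]
        · rintro x ⟨hx, hxE⟩
          have := hh ⟨x, hxE⟩
          refine h₁.le ⟨?_, hxE⟩
          change h (C.mkQ x) ∈ D at hx
          change h (C.mkQ x) = x at this
          rwa [this] at hx
      rw [eq_bot_iff]
      intro d hd
      obtain ⟨y, rfl⟩ := hD hd
      obtain ⟨y, rfl⟩ := C.mkQ_surjective y
      have : y ∈ C := h₂ hd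
      have : C.mkQ y = 0 := by simpa using this
      simp [this]
    · exact fun x hx => ⟨_, hh ⟨x, hx⟩⟩
  refine ⟨E, inferInstance, inferInstance, f₀.hom.codRestrict E fun x => hE.prop.1 ⟨x, rfl⟩,
    ⟨?_⟩, fun x y hxy => hf₀ (congrArg Subtype.val hxy), ?_⟩
  · intro X Y _ _ _ _ f hf g
    obtain ⟨u, hu⟩ := hinj.out f hf (E.subtype ∘ₗ g)
    refine ⟨(h ∘ₗ C.mkQ ∘ₗ u).codRestrict E fun x => hrange ⟨_, rfl⟩, fun x => Subtype.ext ?_⟩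
    have := hh (g x)
    change h (C.mkQ (u (f x))) = g x
    rw [hu]
    exact this
  · intro L hL
    have : L.map E.subtype = ⊥ := by
      refine hE.prop.2 _ (Submodule.map_subtype_le _ _) ?_
      rw [eq_bot_iff]
      rintro _ ⟨⟨x, hx, rfl⟩, y, hy⟩
      have : x ∈ L ⊓ LinearMap.range (f₀.hom.codRestrict E fun x => hE.prop.1 ⟨x, rfl⟩) :=
        ⟨hx, y, Subtype.ext hy⟩
      rw [hL] at this
      simpa using this
    exact Submodule.map_injective_of_injective E.injective_subtype (by rw [this, Submodule.map_bot])

/-- An injective module in which the elements annihilated by a maximal ideal form a simple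
submodule, for every maximal ideal. -/
structure IsMinimalCogenerator (k : Type w) [CommRing k] (I : Type w) [AddCommGroup I]
    [Module k I] : Prop where
  injective : Module.Injective k I
  exists_torsion : ∀ m : Ideal k, m.IsMaximal → ∃ x : I, x ≠ 0 ∧ ∀ r ∈ m, r • x = 0
  torsion_cyclic : ∀ m : Ideal k, m.IsMaximal → ∀ x y : I, x ≠ 0 → (∀ r ∈ m, r • x = 0) →
    (∀ r ∈ m, r • y = 0) → ∃ s : k, y = s • x

/-- The injective hull of the product of all residue fields works: in that product the elements
killed by `m` form exactly the factor `k ⧸ m`, and essentiality carries this over to the hull. -/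
theorem exists_isMinimalCogenerator (k : Type w) [CommRing k] :
    ∃ (I : Type w) (_ : AddCommGroup I) (_ : Module k I), IsMinimalCogenerator k I := by
  classical
  obtain ⟨I, _, _, f, hI, hf, hess⟩ :=
    exists_isInjectiveHull (k := k) (∀ m : MaximalSpectrum k, k ⧸ m.asIdeal)
  refine ⟨I, _, _, hI, fun m hm => ?_, fun m hm => ?_⟩
  · refine ⟨f (Pi.single ⟨m, hm⟩ 1), fun h => ?_, fun r hr => ?_⟩
    · rw [← map_zero f] at h
      have := congrFun (hf h) ⟨m, hm⟩
      rw [Pi.single_eq_same] at this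
      exact one_ne_zero this
    · rw [← map_smul, ← Pi.single_smul, Algebra.smul_def, mul_one, Ideal.Quotient.algebraMap_eq,
        Ideal.Quotient.eq_zero_iff_mem.2 hr, Pi.single_zero, map_zero]
  · have key : ∀ x : I, x ≠ 0 → (∀ r ∈ m, r • x = 0) →
        ∃ t : k, ∃ v : k ⧸ m, t • x = f (Pi.single ⟨m, hm⟩ v) ∧ t • x ≠ 0 := by
      intro x hx hmx
      have : k ∙ x ⊓ LinearMap.range f ≠ ⊥ := fun h => hx (by simpa using hess _ h)
      obtain ⟨y, ⟨hy, w, hw⟩, hy0⟩ := Submodule.exists_mem_ne_zero_of_ne_bot this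
      obtain ⟨t, rfl⟩ := Submodule.mem_span_singleton.1 hy
      refine ⟨t, w ⟨m, hm⟩, ?_, hy0⟩
      rw [← hw]
      congr 1
      funext n
      by_cases hn : n = ⟨m, hm⟩
      · subst hn; simp
      · rw [Pi.single_eq_of_ne hn]
        -- Some `r ∈ m` outside `n` kills `w` but acts injectively on `k ⧸ n`, so the coordinate at
        -- `n` vanishes.
        have hmn : ¬ m ≤ n.asIdeal := fun h =>
          hn (MaximalSpectrum.ext (hm.eq_of_le n.isMaximal.ne_top h).symm)
        obtain ⟨r, hr, hrn⟩ := SetLike.not_le_iff_exists.1 hmn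
        have h0 : r • w = 0 := hf (by rw [map_smul, hw, smul_comm, hmx r hr, smul_zero, map_zero])
        have h1 := congrFun h0 n
        rw [Pi.smul_apply, Algebra.smul_def, Ideal.Quotient.algebraMap_eq] at h1
        exact (mul_eq_zero.1 h1).resolve_left fun h => hrn (Ideal.Quotient.eq_zero_iff_mem.1 h)
    have scale : ∀ x : I, (∀ r ∈ m, r • x = 0) → ∀ t : k, t • x ≠ 0 →
        ∃ s : k, x = s • t • x := by
      intro x hmx t ht
      have htm : t ∉ m := fun h => ht (hmx t h)
      obtain ⟨s, hs⟩ := hm.exists_inv htm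
      obtain ⟨i, hi, hsi⟩ := hs
      refine ⟨s, ?_⟩
      rw [smul_smul]
      calc x = (s * t + i) • x := by rw [hsi, one_smul]
        _ = (s * t) • x := by rw [add_smul, hmx i hi, add_zero]
    intro x y hx hmx hmy
    by_cases hy : y = 0
    · exact ⟨0, by simp [hy]⟩
    obtain ⟨t, v, htv, ht⟩ := key x hx hmx
    obtain ⟨t', v', htv', ht'⟩ := key y hy hmy
    obtain ⟨s, hs⟩ := scale y hmy t' ht'
    have hv : v ≠ 0 := by rintro rfl; simp [htv] at ht
    obtain ⟨c, hc⟩ : ∃ c : k, v' = c • v := by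
      let := Ideal.Quotient.field m
      obtain ⟨c, hc⟩ := Ideal.Quotient.mk_surjective (v' / v)
      refine ⟨c, ?_⟩
      rw [Algebra.smul_def, Ideal.Quotient.algebraMap_eq, hc, div_mul_cancel₀ _ hv]
    refine ⟨s * c * t, ?_⟩
    rw [hs, htv', hc, Pi.single_smul, map_smul, ← htv]
    simp only [smul_smul, mul_assoc]

/-- `Hom(-, I)` is exact, and it sends `k ⧸ m` to the `m`-torsion of `I`, which has length at most
one. The inequality suffices for the counting in `exists_eq_smul`. -/
theorem IsMinimalCogenerator.length_le_of_isFiniteLength {k : Type w} [CommRing k] {I : Type w}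
    [AddCommGroup I] [Module k I] (hI : IsMinimalCogenerator k I) {N : Type w} [AddCommGroup N]
    [Module k N] (hN : IsFiniteLength k N) :
    Module.length k (N →ₗ[k] I) ≤ Module.length k N := by
  induction hN with
  | of_subsingleton => 
    rename_i N _ _ _
    have : Subsingleton (N →ₗ[k] I) := ⟨fun f g => LinearMap.ext fun x => by
      rw [Subsingleton.elim x 0, map_zero, map_zero]⟩
    simp [Module.length_eq_zero]
  | @of_simple_quotient N _ _ S hS _ ih =>
    have h1 := Module.length_eq_add_of_exact S.subtype S.mkQ S.injective_subtype S.mkQ_surjective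
      (LinearMap.exact_subtype_mkQ S)
    have hsurj : Function.Surjective (LinearMap.lcomp k I S.subtype) := fun g => by
      obtain ⟨h, hh⟩ := hI.injective.out S.subtype S.injective_subtype g
      exact ⟨h, LinearMap.ext hh⟩
    have hinj : Function.Injective (LinearMap.lcomp k I S.mkQ) := fun g g' h =>
      LinearMap.ext fun x => by
        obtain ⟨x, rfl⟩ := S.mkQ_surjective x
        exact LinearMap.congr_fun h x
    have hex : Function.Exact (LinearMap.lcomp k I S.mkQ) (LinearMap.lcomp k I S.subtype) := by
      intro g
      constructor
      · intro hg
        refine ⟨S.liftQ g fun x hx => LinearMap.congr_fun hg ⟨x, hx⟩, ?_⟩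
        ext x; rfl
      · rintro ⟨g, rfl⟩
        ext x
        change g (S.mkQ x) = 0
        rw [(Submodule.Quotient.mk_eq_zero S).2 x.2 |> fun h => (h : S.mkQ x = 0), map_zero]
    have h2 := Module.length_eq_add_of_exact _ _ hinj hsurj hex
    rw [h1, h2, add_comm]
    refine add_le_add ih ?_
    rw [Module.length_eq_one k (N ⧸ S)]
    obtain ⟨m, hm, ⟨e⟩⟩ := isSimpleModule_iff_quot_maximal.1 hS
    have hle : Module.length k ((k ⧸ m) →ₗ[k] I) ≤ 1 := by
      rcases subsingleton_or_nontrivial ((k ⧸ m) →ₗ[k] I) with h | h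
      · simp [Module.length_eq_zero]
      · rw [(Module.length_eq_one_iff).2]
        have hz : ∀ g : (k ⧸ m) →ₗ[k] I, ∀ r ∈ m, r • g 1 = 0 := by
          intro g r hr
          rw [← map_smul, Algebra.smul_def, mul_one, Ideal.Quotient.algebraMap_eq,
            Ideal.Quotient.eq_zero_iff_mem.2 hr, map_zero]
        have hext : ∀ g g' : (k ⧸ m) →ₗ[k] I, g 1 = g' 1 → g = g' := by
          intro g g' h
          ext
          simpa using h
        refine isSimpleModule_iff_toSpanSingleton_surjective.2 ⟨h, fun x hx y => ?_⟩
        obtain ⟨s, hs⟩ := hI.torsion_cyclic m hm (x 1) (y 1)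
          (fun h0 => hx (hext _ _ (by simpa using h0))) (hz x) (hz y)
        exact ⟨s, hext _ _ (by simp [hs])⟩
    refine le_trans (le_of_eq ?_) hle
    exact (LinearEquiv.congrLeft I k e).length_eq

theorem IsMinimalCogenerator.exists_ne_zero {k : Type w} [CommRing k] {I : Type w}
    [AddCommGroup I] [Module k I] (hI : IsMinimalCogenerator k I) {N : Type w} [AddCommGroup N]
    [Module k N] [Module.Finite k N] [Nontrivial N] : ∃ g : N →ₗ[k] I, g ≠ 0 := by
  obtain ⟨S, hS, -⟩ := (eq_top_or_exists_le_coatom (⊥ : Submodule k N)).resolve_left bot_ne_top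
  have := isSimpleModule_iff_isCoatom.2 hS
  obtain ⟨m, hm, ⟨e⟩⟩ := isSimpleModule_iff_quot_maximal.1 this
  obtain ⟨x, hx, hmx⟩ := hI.exists_torsion m hm
  refine ⟨m.liftQ (LinearMap.toSpanSingleton k I x) (fun r hr => hmx r hr) ∘ₗ e.toLinearMap ∘ₗ
    S.mkQ, fun h => hx ?_⟩
  obtain ⟨y, hy⟩ := (e.surjective.comp S.mkQ_surjective) (Submodule.Quotient.mk 1)
  have h1 := LinearMap.congr_fun h y
  simp only [Function.comp_apply] at hy
  rw [LinearMap.comp_apply, LinearMap.comp_apply, LinearEquiv.coe_coe, hy] at h1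
  rw [← one_smul k x]
  exact h1

open MulOpposite

/-! ### Right ideals of basic idempotents and the simple modules. -/

section Idempotents

variable {B : Type w} [Ring B]

/-- The right ideal `{b | e b = b}`, which is `e B` for an idempotent `e`. -/
def rightIdeal (e : B) : Submodule Bᵐᵒᵖ B where
  carrier := {b | e * b = b}
  add_mem' {b c} hb hc := by
    change e * (b + c) = b + c
    rw [mul_add, hb, hc]
  zero_mem' := mul_zero e
  smul_mem' c b hb := by
    change e * (b * c.unop) = b * c.unop
    rw [← mul_assoc, hb]

theorem mem_rightIdeal {e b : B} : b ∈ rightIdeal e ↔ e * b = b := Iff.rfl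

/-- The right module `top (e B)`. -/
abbrev topRightIdeal (e : B) : ModuleCat.{w} Bᵐᵒᵖ :=
  ModuleCat.of _ (rightIdeal e ⧸ Module.jacobson Bᵐᵒᵖ (rightIdeal e))

variable {ι : Type z} [Fintype ι]

/-- Complete orthogonal idempotents `e a` such that `B / J` is the product of the division
rings `e a B e a / e a J e a`. -/
structure IsBasicIdempotents (e : ι → B) : Prop extends CompleteOrthogonalIdempotents e where
  mem_or_exists : ∀ a x, e a * x * e a ∈ Ring.jacobson B ∨ ∃ y, e a * x * e a * y = e a
  mul_mul_mem : ∀ a c x, a ≠ c → e a * x * e c ∈ Ring.jacobson B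
  notMem : ∀ a, e a ∉ Ring.jacobson B

namespace IsBasicIdempotents

variable {e : ι → B} (h : IsBasicIdempotents e)
include h

theorem mul_self (a : ι) : e a * e a = e a := h.idem a

theorem self_mem (a : ι) : e a ∈ rightIdeal (e a) := h.mul_self a

theorem mul_mem (a : ι) (b : B) : e a * b ∈ rightIdeal (e a) := by
  rw [mem_rightIdeal, ← mul_assoc, h.mul_self]

/-- The off-diagonal corners lie in the radical, so an element of `e a B` outside the radical has
its diagonal corner outside it, where `mem_or_exists` gives a right inverse. -/
theorem exists_mul_eq {a : ι} {b : B} (hb : e a * b ∉ Ring.jacobson B) :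
    ∃ y, e a * b * y = e a := by
  have hmem : e a * b * e a ∉ Ring.jacobson B := by
    classical
    intro hmem
    refine hb ?_
    rw [← mul_one (e a * b), ← h.complete, Finset.mul_sum]
    refine Submodule.sum_mem _ fun c _ => ?_
    by_cases hac : a = c
    · exact hac ▸ hmem
    · exact h.mul_mul_mem a c b hac
  obtain ⟨y, hy⟩ := (h.mem_or_exists a b).resolve_left hmem
  exact ⟨e a * y, by rw [← mul_assoc, hy]⟩

theorem eq_top_of_notMem {a : ι} {N : Submodule Bᵐᵒᵖ (rightIdeal (e a))} {b : rightIdeal (e a)}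
    (hb : b ∈ N) (hbJ : (b : B) ∉ Ring.jacobson B) : N = ⊤ := by
  have hb' : e a * b = b := b.2
  obtain ⟨y, hy⟩ := h.exists_mul_eq (a := a) (b := (b : B)) (by rwa [hb'])
  refine (Submodule.eq_top_iff').2 fun x => ?_
  have : x = op (y * (x : B)) • b := Subtype.ext (by
    change (x : B) = b * (y * x)
    rw [← mul_assoc, ← hb', hy]
    exact (x.2 : e a * x = x).symm)
  rw [this]
  exact N.smul_mem _ hb

/-- The submodule `e a J` of `e a B`. -/
theorem mem_jacobson_rightIdeal {a : ι} {b : rightIdeal (e a)} :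
    b ∈ Module.jacobson Bᵐᵒᵖ (rightIdeal (e a)) ↔ (b : B) ∈ Ring.jacobson B := by
  constructor
  · intro hb
    let C : Submodule Bᵐᵒᵖ (rightIdeal (e a)) :=
      { carrier := {b | (b : B) ∈ Ring.jacobson B}
        add_mem' := fun hb hc => (Ring.jacobson B).add_mem hb hc
        zero_mem' := (Ring.jacobson B).zero_mem
        smul_mem' := fun c b hb => (Ring.jacobson B).mul_mem_right c.unop hb }
    have hC : IsCoatom C := by
      refine ⟨fun hC => h.notMem a ?_, fun D hD => ?_⟩
      · have : (⟨e a, h.self_mem a⟩ : rightIdeal (e a)) ∈ C := hC ▸ Submodule.mem_top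
        exact this
      · obtain ⟨d, hd, hdC⟩ := SetLike.exists_of_lt hD
        exact h.eq_top_of_notMem hd hdC
    exact Submodule.mem_sInf.1 hb C hC
  · intro hb
    refine Submodule.mem_sInf.2 fun D hD => ?_
    by_contra hbD
    have hsup := hD.2 (D ⊔ Submodule.span Bᵐᵒᵖ {b})
      (lt_of_le_of_ne le_sup_left fun hEq => hbD (by
        rw [hEq]; exact Submodule.mem_sup_right (Submodule.mem_span_singleton_self b)))
    have hmem : (⟨e a, h.self_mem a⟩ : rightIdeal (e a)) ∈ D ⊔ Submodule.span Bᵐᵒᵖ {b} :=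
      hsup ▸ Submodule.mem_top
    obtain ⟨d, hd, c, hc, hdc⟩ := Submodule.mem_sup.1 hmem
    obtain ⟨r, rfl⟩ := Submodule.mem_span_singleton.1 hc
    refine hD.1 (h.eq_top_of_notMem hd fun hdJ => h.notMem a ?_)
    have : (d : B) + b * r.unop = e a := congrArg Subtype.val hdc
    rw [← this]
    exact (Ring.jacobson B).add_mem hdJ ((Ring.jacobson B).mul_mem_right _ hb)

theorem eq_top_of_not_le {a : ι} {N : Submodule Bᵐᵒᵖ (rightIdeal (e a))}
    (hN : ¬ N ≤ Module.jacobson Bᵐᵒᵖ (rightIdeal (e a))) : N = ⊤ := by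
  obtain ⟨b, hb, hbJ⟩ := SetLike.not_le_iff_exists.1 hN
  exact h.eq_top_of_notMem hb fun hJ => hbJ (h.mem_jacobson_rightIdeal.2 hJ)

theorem isCoatom_jacobson (a : ι) : IsCoatom (Module.jacobson Bᵐᵒᵖ (rightIdeal (e a))) := by
  refine ⟨fun hC => h.notMem a ?_, fun D hD => h.eq_top_of_not_le hD.not_ge⟩
  have : (⟨e a, h.self_mem a⟩ : rightIdeal (e a)) ∈ Module.jacobson Bᵐᵒᵖ (rightIdeal (e a)) :=
    hC ▸ Submodule.mem_top
  exact h.mem_jacobson_rightIdeal.1 this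

theorem isSimpleModule_top (a : ι) : IsSimpleModule Bᵐᵒᵖ (topRightIdeal (e a)) :=
  isSimpleModule_iff_isCoatom.2 (h.isCoatom_jacobson a)

theorem smul_top_eq_zero {a c : ι} (hac : a ≠ c) (s : topRightIdeal (e a)) :
    op (e c) • s = 0 := by
  obtain ⟨b, rfl⟩ := Submodule.Quotient.mk_surjective _ s
  refine (Submodule.Quotient.mk_eq_zero _).2 (h.mem_jacobson_rightIdeal.2 ?_)
  change (b : B) * e c ∈ _
  rw [← (b.2 : e a * b = b)]
  exact h.mul_mul_mem a c b hac

theorem exists_smul_top_ne_zero (a : ι) : ∃ s : topRightIdeal (e a), op (e a) • s ≠ 0 := by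
  refine ⟨Submodule.Quotient.mk ⟨e a, h.self_mem a⟩, fun h0 => h.notMem a ?_⟩
  have := h.mem_jacobson_rightIdeal.1 ((Submodule.Quotient.mk_eq_zero _).1 h0)
  change e a * e a ∈ _ at this
  rwa [h.mul_self] at this

omit [Fintype ι] h in
/-- The homomorphism `b ↦ n b` from `e B` to a right module. -/
def fromRightIdeal (e : B) {N : Type v} [AddCommGroup N] [Module Bᵐᵒᵖ N] (n : N) :
    rightIdeal e →ₗ[Bᵐᵒᵖ] N where
  toFun b := op (b : B) • n
  map_add' b c := by rw [Submodule.coe_add, op_add, add_smul]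
  map_smul' c b := by
    rw [RingHom.id_apply, smul_smul]
    rfl

section RightModules

variable {N : Type w} [AddCommGroup N] [Module Bᵐᵒᵖ N]

theorem exists_smul_ne_zero {n : N} (hn : n ≠ 0) : ∃ a, op (e a) • n ≠ 0 := by
  by_contra! h0
  refine hn ?_
  rw [← one_smul Bᵐᵒᵖ n, ← op_one, ← h.complete, Finset.op_sum, Finset.sum_smul]
  exact Finset.sum_eq_zero fun a _ => h0 a

theorem fromRightIdeal_self {a : ι} (n : N) :
    fromRightIdeal (e a) (op (e a) • n) ⟨e a, h.self_mem a⟩ = op (e a) • n := by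
  change op (e a) • op (e a) • n = _
  rw [smul_smul, ← op_mul, h.mul_self]

theorem ker_fromRightIdeal_le {a : ι} {n : N} (hn : op (e a) • n ≠ 0) :
    LinearMap.ker (fromRightIdeal (e a) (op (e a) • n)) ≤
      Module.jacobson Bᵐᵒᵖ (rightIdeal (e a)) := by
  by_contra hle
  have htop := h.eq_top_of_not_le hle
  refine hn ?_
  rw [← h.fromRightIdeal_self]
  have : (⟨e a, h.self_mem a⟩ : rightIdeal (e a)) ∈
    LinearMap.ker (fromRightIdeal (e a) (op (e a) • n)) := htop ▸ Submodule.mem_top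
  exact this

theorem nonempty_top_equiv [IsSimpleModule Bᵐᵒᵖ N] {a : ι} {n : N} (hn : op (e a) • n ≠ 0) :
    Nonempty (topRightIdeal (e a) ≃ₗ[Bᵐᵒᵖ] N) := by
  set φ := fromRightIdeal (e a) (op (e a) • n)
  have hφ : φ ≠ 0 := fun h0 => hn (by rw [← h.fromRightIdeal_self, ← LinearMap.zero_apply
    (σ₁₂ := RingHom.id Bᵐᵒᵖ) (M₂ := N) (⟨e a, h.self_mem a⟩ : rightIdeal (e a)), ← h0])
  have hsurj := φ.surjective_of_ne_zero hφ
  have hker : Module.jacobson Bᵐᵒᵖ (rightIdeal (e a)) = LinearMap.ker φ := by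
    refine ((h.ker_fromRightIdeal_le hn).eq_or_lt.resolve_right fun hlt => ?_).symm
    have hco : IsCoatom (LinearMap.ker φ) := by
      have := IsSimpleModule.congr (φ.quotKerEquivOfSurjective hsurj)
      exact isSimpleModule_iff_isCoatom.1 this
    exact (h.isCoatom_jacobson a).1 (hco.2 _ hlt)
  exact ⟨(Submodule.quotEquivOfEq _ _ hker).trans (φ.quotKerEquivOfSurjective hsurj)⟩

/-- `S c` is the only simple module on which `e c` acts nontrivially, so being free of the factor `S
c` amounts to being killed by `e c`. -/
theorem hasFactorsIn_iff {p : ι → Prop} {N' : Submodule Bᵐᵒᵖ N} :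
    HasFactorsIn (fun a => topRightIdeal (e a)) p N' ↔
      ∀ c, ¬ p c → ∀ n ∈ N', op (e c) • n = 0 := by
  constructor
  · intro hN' c hc n hn
    by_contra h0
    set φ := fromRightIdeal (e c) (op (e c) • n) with hφ
    set C := Module.jacobson Bᵐᵒᵖ (rightIdeal (e c))
    have hker : LinearMap.ker φ ≤ C := h.ker_fromRightIdeal_le h0
    have hcomap : (C.map φ).comap φ = C := Submodule.comap_map_eq_self hker
    have hself : φ ⟨e c, h.self_mem c⟩ = op (e c) • n := h.fromRightIdeal_self n
    have hnotMem : op (e c) • n ∉ C.map φ := by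
      rw [← hself, ← Submodule.mem_comap, hcomap]
      exact fun hmem => h.notMem c (h.mem_jacobson_rightIdeal.1 hmem)
    have hmem : op (e c) • n ∈ LinearMap.range φ := ⟨_, hself⟩
    -- The submodule generated by `n e_c` is a quotient of `e_c B`; its top is a composition factor
    -- on which `e c` does not vanish.
    obtain ⟨j, hj, ⟨E⟩⟩ := hN' (C.map φ) (LinearMap.range φ) (by
      refine ⟨lt_of_le_of_ne LinearMap.map_le_range fun hEq => hnotMem (hEq ▸ hmem), ?_⟩
      intro D hD hD'
      have hDmap : (D.comap φ).map φ = D := Submodule.map_comap_eq_of_le hD'.le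
      refine hD'.ne ?_
      rw [← hDmap, h.eq_top_of_not_le (N := D.comap φ) fun hle => ?_, LinearMap.range_eq_map]
      refine hD.not_ge ?_
      rw [← hDmap]
      exact Submodule.map_mono hle) (by
      rintro _ ⟨b, rfl⟩
      exact N'.smul_mem _ (N'.smul_mem _ hn))
    have hjc : j = c := by
      by_contra hjc
      refine hnotMem ?_
      have h1 := h.smul_top_eq_zero hjc (E (Submodule.Quotient.mk ⟨op (e c) • n, hmem⟩))
      rw [← map_smul, LinearEquiv.map_eq_zero_iff, ← Submodule.Quotient.mk_smul,
        Submodule.Quotient.mk_eq_zero] at h1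
      have h2 : op (e c) • op (e c) • n ∈ C.map φ := h1
      rwa [smul_smul, ← op_mul, h.mul_self] at h2
    exact hc (hjc ▸ hj)
  · intro hN' L₀ L₁ hL hL₁
    have hs : IsSimpleModule Bᵐᵒᵖ (L₁ ⧸ L₀.submoduleOf L₁) := (covBy_iff_quot_is_simple hL.le).1 hL
    have := IsSimpleModule.nontrivial Bᵐᵒᵖ (L₁ ⧸ L₀.submoduleOf L₁)
    obtain ⟨x, hx⟩ := exists_ne (0 : L₁ ⧸ L₀.submoduleOf L₁)
    obtain ⟨c, hc⟩ := h.exists_smul_ne_zero hx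
    refine ⟨c, ?_, ⟨(h.nonempty_top_equiv hc).some.symm⟩⟩
    by_contra hpc
    refine hc ?_
    obtain ⟨y, rfl⟩ := Submodule.Quotient.mk_surjective _ x
    rw [← Submodule.Quotient.mk_smul]
    have : op (e c) • y = 0 := Subtype.ext (hN' c hpc y (hL₁ y.2))
    rw [this, Submodule.Quotient.mk_zero]

end RightModules

theorem not_iso_top {a c : ι} (E : topRightIdeal (e a) ≃ₗ[Bᵐᵒᵖ] topRightIdeal (e c)) : a = c := by
  by_contra hac
  obtain ⟨s, hs⟩ := h.exists_smul_top_ne_zero c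
  apply hs
  rw [← E.apply_symm_apply s, ← map_smul, h.smul_top_eq_zero hac, map_zero]

theorem isCompleteSetOfSimples : IsCompleteSetOfSimples (fun a => topRightIdeal (e a)) where
  simple := h.isSimpleModule_top
  not_iso _ _ := fun ⟨E⟩ => h.not_iso_top E
  complete T hT := by
    have := IsSimpleModule.nontrivial Bᵐᵒᵖ T
    obtain ⟨x, hx⟩ := exists_ne (0 : T)
    obtain ⟨a, ha⟩ := h.exists_smul_ne_zero hx
    exact ⟨a, h.nonempty_top_equiv ha⟩

end IsBasicIdempotents

end Idempotents

/-! ### The modules `D(B e_a)` as injective hulls. -/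

section Coinduced

variable (k : Type w) [CommRing k] (B : Type w) [Ring B] [Algebra k B]
  (I : Type w) [AddCommGroup I] [Module k I]

/-- The right `B`-module `Hom_k(B, I)`, with `(f b)(x) = f (b x)`. -/
def Coinduced : Type w := B →ₗ[k] I

instance : AddCommGroup (Coinduced k B I) := inferInstanceAs (AddCommGroup (B →ₗ[k] I))

instance : FunLike (Coinduced k B I) B I := inferInstanceAs (FunLike (B →ₗ[k] I) B I)

instance : LinearMapClass (Coinduced k B I) k B I :=
  inferInstanceAs (LinearMapClass (B →ₗ[k] I) k B I)

variable {k B I}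

@[ext] theorem Coinduced.ext {f g : Coinduced k B I} (h : ∀ x, f x = g x) : f = g :=
  LinearMap.ext h

theorem Coinduced.add_apply (f g : Coinduced k B I) (x : B) : (f + g) x = f x + g x := rfl

theorem Coinduced.zero_apply (x : B) : (0 : Coinduced k B I) x = 0 := rfl

instance : Module Bᵐᵒᵖ (Coinduced k B I) where
  smul c f := LinearMap.comp (f : B →ₗ[k] I) (LinearMap.mulLeft k c.unop)
  one_smul f := Coinduced.ext fun x => congrArg f (one_mul x)
  mul_smul c d f := Coinduced.ext fun x => congrArg f (mul_assoc d.unop c.unop x)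
  smul_zero _ := rfl
  smul_add _ _ _ := rfl
  add_smul c d f := Coinduced.ext fun x =>
    (congrArg f (add_mul c.unop d.unop x)).trans (map_add f _ _)
  zero_smul f := Coinduced.ext fun x => (congrArg f (zero_mul x)).trans (map_zero f)

theorem Coinduced.smul_apply (c : Bᵐᵒᵖ) (f : Coinduced k B I) (x : B) :
    (c • f) x = f (c.unop * x) := rfl

/-- Evaluation at `1` turns `B`-maps into `Hom_k(B, I)` into `k`-maps into `I`; an extension `h'`
over `k` corresponds to `y ↦ (b ↦ h' (y b))`. -/
theorem Coinduced.injective (hI : Module.Injective k I) :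
    Module.Injective Bᵐᵒᵖ (Coinduced k B I) := by
  refine ⟨fun X Y _ _ _ _ f hf g => ?_⟩
  let _ : Module k X := Module.compHom X (algebraMap k Bᵐᵒᵖ)
  let _ : Module k Y := Module.compHom Y (algebraMap k Bᵐᵒᵖ)
  have hX : ∀ (r : k) (x : X), r • x = op (algebraMap k B r) • x := fun _ _ => rfl
  have hY : ∀ (r : k) (y : Y), r • y = op (algebraMap k B r) • y := fun _ _ => rfl
  let f' : X →ₗ[k] Y :=
    { toFun := f
      map_add' := map_add f
      map_smul' := fun r x => by rw [hX, map_smul, RingHom.id_apply, hY] }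
  let g' : X →ₗ[k] I :=
    { toFun := fun x => g x 1
      map_add' := fun x y => by rw [map_add, Coinduced.add_apply]
      map_smul' := fun r x => by
        rw [hX, map_smul, RingHom.id_apply, Coinduced.smul_apply, unop_op, ← Algebra.smul_def,
          map_smul] }
  obtain ⟨h', hh'⟩ := hI.out f' hf g'
  let H : Y → Coinduced k B I := fun y =>
    ({ toFun := fun b => h' (op b • y)
       map_add' := fun b c => by rw [op_add, add_smul, map_add]
       map_smul' := fun r b => by
        rw [RingHom.id_apply, ← map_smul, hY, smul_smul, ← op_mul, ← Algebra.commutes,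
          Algebra.smul_def] } : B →ₗ[k] I)
  have hH : ∀ y b, H y b = h' (op b • y) := fun _ _ => rfl
  refine ⟨{ toFun := H
            map_add' := fun y y' => Coinduced.ext fun b => by
              rw [Coinduced.add_apply, hH, hH, hH, smul_add, map_add]
            map_smul' := fun c y => Coinduced.ext fun b => by
              rw [RingHom.id_apply, Coinduced.smul_apply, hH, hH, smul_smul, op_mul, op_unop] },
    fun x => Coinduced.ext fun b => ?_⟩
  change h' (op b • f x) = g x b
  rw [← map_smul]
  refine (hh' (op b • x)).trans ?_
  change g (op b • x) 1 = _
  rw [map_smul, Coinduced.smul_apply, unop_op, mul_one]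

variable (k I) in
/-- The direct summand of `Hom_k(B, I)` which consists of the `f` with `f (x e) = f x`. It is
isomorphic to `Hom_k(B e, I)`. -/
def dualOf (e : B) : Submodule Bᵐᵒᵖ (Coinduced k B I) where
  carrier := {f | ∀ x, f (x * e) = f x}
  add_mem' {f g} hf hg x := by rw [Coinduced.add_apply, Coinduced.add_apply, hf, hg]
  zero_mem' _ := rfl
  smul_mem' c f hf x := by rw [Coinduced.smul_apply, Coinduced.smul_apply, ← mul_assoc, hf]

/-- The homomorphism `f ↦ f (- p)` of right modules. -/
def Coinduced.mulRight (p : B) : Coinduced k B I →ₗ[Bᵐᵒᵖ] Coinduced k B I where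
  toFun f := LinearMap.comp (f : B →ₗ[k] I) (LinearMap.mulRight k p)
  map_add' _ _ := rfl
  map_smul' c f := Coinduced.ext fun x => congrArg f (mul_assoc c.unop x p).symm

theorem Coinduced.mulRight_apply (p : B) (f : Coinduced k B I) (x : B) :
    Coinduced.mulRight p f x = f (x * p) := rfl

theorem dualOf_injective (hI : Module.Injective k I) {e : B} (he : e * e = e) :
    Module.Injective Bᵐᵒᵖ (dualOf k I e) := by
  refine ⟨fun X Y _ _ _ _ f hf g => ?_⟩
  obtain ⟨h, hh⟩ := (Coinduced.injective (B := B) hI).out f hf ((dualOf k I e).subtype ∘ₗ g)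
  refine ⟨(Coinduced.mulRight e ∘ₗ h).codRestrict _ fun y x => ?_, fun x =>
    Subtype.ext (Coinduced.ext fun b => ?_)⟩
  · simp only [LinearMap.comp_apply, Coinduced.mulRight_apply, mul_assoc, he]
  · change h (f x) (b * e) = _
    rw [hh]
    exact (g x).2 b

namespace IsBasicIdempotents

variable {ι : Type z} [Fintype ι] {e : ι → B} (h : IsBasicIdempotents e)
include h

theorem sub_mul_mul_mem (a : ι) (x : B) : (x - e a * x) * e a ∈ Ring.jacobson B := by
  classical
  have : x - e a * x = ∑ c ∈ Finset.univ.erase a, e c * x := by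
    rw [sub_eq_iff_eq_add, Finset.sum_erase_add _ _ (Finset.mem_univ a), ← Finset.sum_mul,
      h.complete, one_mul]
  rw [this, Finset.sum_mul]
  exact Submodule.sum_mem _ fun c hc => h.mul_mul_mem c a x (Finset.ne_of_mem_erase hc)

/-- Modulo the radical `x e_a` and `e_a x e_a` agree, and `f` only sees these. -/
theorem apply_mul_left {a : ι} {f : Coinduced k B I} (hf : f ∈ dualOf k I (e a))
    (hfJ : ∀ j ∈ Ring.jacobson B, f j = 0) (x : B) : f (e a * x) = f x := by
  have := hfJ _ (h.sub_mul_mul_mem a x)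
  rw [hf, map_sub, sub_eq_zero] at this
  exact this.symm

omit [Fintype ι] h in
variable (k) in
/-- The `k`-submodule of the `x` with `x e` in the radical of `B`. -/
def radPart (e : B) : Submodule k B where
  carrier := {x | x * e ∈ Ring.jacobson B}
  add_mem' {x y} hx hy := by
    change (x + y) * e ∈ Ring.jacobson B
    rw [add_mul]
    exact (Ring.jacobson B).add_mem hx hy
  zero_mem' := by
    change 0 * e ∈ Ring.jacobson B
    rw [zero_mul]
    exact (Ring.jacobson B).zero_mem
  smul_mem' r x hx := by
    change (r • x) * e ∈ Ring.jacobson B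
    rw [Algebra.smul_def, mul_assoc]
    exact (Ring.jacobson B).mul_mem_left _ hx

omit [Fintype ι] h in
theorem mem_radPart {e x : B} : x ∈ radPart k e ↔ x * e ∈ Ring.jacobson B := Iff.rfl

omit h [Fintype ι] in
theorem radPart_le_ker {e : B} {f : Coinduced k B I} (hf : f ∈ dualOf k I e)
    (hfJ : ∀ j ∈ Ring.jacobson B, f j = 0) : radPart k e ≤ LinearMap.ker (f : B →ₗ[k] I) := by
  intro x hx
  have := hfJ _ hx
  rwa [hf] at this

/-- The socle of `dualOf k I (e a)` is generated by each of its nonzero elements. -/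
theorem exists_eq_smul [IsArtinianRing k] [Module.Finite k B] (hI : IsMinimalCogenerator k I)
    {a : ι} {f g : Coinduced k B I} (hf : f ∈ dualOf k I (e a)) (hg : g ∈ dualOf k I (e a))
    (hfJ : ∀ j ∈ Ring.jacobson B, f j = 0) (hgJ : ∀ j ∈ Ring.jacobson B, g j = 0)
    (hg0 : g ≠ 0) : ∃ d : B, f = op d • g := by
  set U := radPart k (e a)
  have hU : ∀ d : B, U ≤ LinearMap.ker (LinearMap.comp (g : B →ₗ[k] I) (LinearMap.mulLeft k d)) :=
    fun d x hx => by
      refine radPart_le_ker hg hgJ (x := d * x) ?_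
      rw [mem_radPart, mul_assoc]
      exact (Ring.jacobson B).mul_mem_left d hx
  -- Surjectivity of `φ` is the claim. Its kernel lies in `U`, so its range is at least as long as
  -- `B ⧸ U`, which in turn is at least as long as the target.
  let φ : B →ₗ[k] ((B ⧸ U) →ₗ[k] I) :=
    { toFun := fun d => U.liftQ _ (hU d)
      map_add' := fun c d => Submodule.linearMap_qext _ (LinearMap.ext fun x =>
        (congrArg g (add_mul c d x)).trans (map_add g _ _))
      map_smul' := fun r d => Submodule.linearMap_qext _ (LinearMap.ext fun x =>
        (congrArg g (smul_mul_assoc r d x)).trans (map_smul g _ _)) }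
  have hφ : ∀ d x, φ d (U.mkQ x) = g (d * x) := fun _ _ => rfl
  have hker : LinearMap.ker φ ≤ U := by
    intro d hd
    by_contra hdU
    have hed : e a * (d * e a) ∉ Ring.jacobson B := fun hmem => hdU (by
      have := (Ring.jacobson B).add_mem (h.sub_mul_mul_mem a d) hmem
      rwa [← mul_assoc, ← add_mul, sub_add_cancel] at this)
    obtain ⟨y, hy⟩ := h.exists_mul_eq hed
    refine hg0 (Coinduced.ext fun x => ?_)
    have h1 : g (d * (e a * (y * x))) = 0 := by
      rw [← hφ, LinearMap.mem_ker.1 hd, LinearMap.zero_apply]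
    rw [← h.apply_mul_left hg hgJ] at h1
    rw [← h.apply_mul_left hg hgJ, ← hy, Coinduced.zero_apply, ← h1]
    simp only [mul_assoc]
  have hfin : IsFiniteLength k (B ⧸ U) :=
    isFiniteLength_iff_isNoetherian_isArtinian.2 ⟨inferInstance, inferInstance⟩
  have hle := hI.length_le_of_isFiniteLength hfin
  have hfin' : IsFiniteLength k ((B ⧸ U) →ₗ[k] I) :=
    Module.length_ne_top_iff.1 (ne_top_of_le_ne_top (Module.length_ne_top_iff.2 hfin) hle)
  obtain ⟨_, _⟩ := isFiniteLength_iff_isNoetherian_isArtinian.1 hfin'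
  have hrange : LinearMap.range φ = ⊤ := by
    by_contra hne
    refine (Submodule.length_lt hne).not_ge (hle.trans ?_)
    rw [← φ.quotKerEquivRange.length_eq]
    exact Module.length_le_of_surjective (Submodule.factor hker) (Submodule.factor_surjective hker)
  obtain ⟨d, hd⟩ := LinearMap.range_eq_top.1 hrange (U.liftQ f (radPart_le_ker hf hfJ))
  refine ⟨d, Coinduced.ext fun x => ?_⟩
  have := LinearMap.congr_fun hd (U.mkQ x)
  exact this.symm

theorem exists_socle_generator [Module.Finite k B] (hI : IsMinimalCogenerator k I) (a : ι) :
    ∃ g : Coinduced k B I, g ∈ dualOf k I (e a) ∧ (∀ j ∈ Ring.jacobson B, g j = 0) ∧ g ≠ 0 := by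
  have : Nontrivial (B ⧸ radPart k (e a)) := by
    refine Submodule.Quotient.nontrivial_iff.2 fun htop => h.notMem a ?_
    have : (1 : B) ∈ radPart k (e a) := htop ▸ Submodule.mem_top
    rwa [mem_radPart, one_mul] at this
  obtain ⟨g, hg⟩ := hI.exists_ne_zero (N := B ⧸ radPart k (e a))
  refine ⟨g ∘ₗ (radPart k (e a)).mkQ, fun x => congrArg g ?_, fun j hj => ?_, fun h0 => hg ?_⟩
  · refine (Submodule.Quotient.eq _).2 ?_
    rw [mem_radPart, sub_mul, mul_assoc, h.mul_self, sub_self]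
    exact (Ring.jacobson B).zero_mem
  · refine (congrArg g ((Submodule.Quotient.mk_eq_zero _).2 ?_)).trans (map_zero g)
    exact (Ring.jacobson B).mul_mem_right _ hj
  · exact Submodule.linearMap_qext _ h0

/-- The functionals killed by the radical are generated by any nonzero one of them, by
`exists_eq_smul`. As the radical is nilpotent, every nonzero submodule contains such a functional,
so the embedding of the simple top is essential. -/
theorem exists_isInjectiveHull_dualOf [IsArtinianRing k] [Module.Finite k B]
    (hI : IsMinimalCogenerator k I) (a : ι) :
    ∃ f : topRightIdeal (e a) →ₗ[Bᵐᵒᵖ] dualOf k I (e a), IsInjectiveHull f := by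
  obtain ⟨g, hg, hgJ, hg0⟩ := h.exists_socle_generator hI a
  set φ := fromRightIdeal (e a) (⟨g, hg⟩ : dualOf k I (e a))
  have hφ : ∀ b x, (φ b : Coinduced k B I) x = g (b * x) := fun _ _ => rfl
  have hker : Module.jacobson Bᵐᵒᵖ (rightIdeal (e a)) ≤ LinearMap.ker φ := fun b hb =>
    Subtype.ext (Coinduced.ext fun x =>
      hgJ _ ((Ring.jacobson B).mul_mem_right x (h.mem_jacobson_rightIdeal.1 hb)))
  refine ⟨Submodule.liftQ _ φ hker, dualOf_injective hI.injective (h.mul_self a), ?_,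
    fun L hL => ?_⟩
  · have := h.isSimpleModule_top a
    refine (LinearMap.injective_or_eq_zero _).resolve_right fun h0 => hg0 ?_
    refine Coinduced.ext fun x => ?_
    rw [← h.apply_mul_left hg hgJ, ← hφ ⟨e a, h.self_mem a⟩]
    have : φ ⟨e a, h.self_mem a⟩ = 0 := LinearMap.congr_fun h0 (Submodule.Quotient.mk _)
    rw [this]
    rfl
  · by_contra hL0
    obtain ⟨f, hf, hf0⟩ := Submodule.exists_mem_ne_zero_of_ne_bot hL0
    have : IsArtinianRing B := isArtinian_of_tower k inferInstance
    have hex : ∃ n, ∀ j ∈ Ring.jacobson B ^ n, op j • f = 0 := by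
      obtain ⟨n, hn⟩ := IsSemiprimaryRing.isNilpotent (R := B)
      refine ⟨n, fun j hj => ?_⟩
      rw [hn, Ideal.zero_eq_bot, Ideal.mem_bot] at hj
      rw [hj, op_zero, zero_smul]
    classical
    -- With `n + 1` the least power of the radical that kills `f`, some `j` in the `n`-th power
    -- gives `f j ≠ 0` killed by the radical.
    obtain ⟨n, hn⟩ : ∃ n, Nat.find hex = n + 1 := by
      refine Nat.exists_eq_succ_of_ne_zero fun h0 => hf0 ?_
      have := (Nat.find_eq_zero hex).1 h0 1 (by
        rw [Submodule.pow_zero, Ideal.one_eq_top]; exact Submodule.mem_top)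
      rwa [op_one, one_smul] at this
    have hnot := Nat.find_min hex (m := n) (by omega)
    push Not at hnot
    obtain ⟨j, hj, hjf⟩ := hnot
    have hspec := Nat.find_spec hex
    rw [hn] at hspec
    obtain ⟨d, hd⟩ := h.exists_eq_smul hI (op j • f).2 hg (fun i hi => by
      have h1 := congrArg (fun u : dualOf k I (e a) => (u : Coinduced k B I) 1)
        (hspec (j * i) (by rw [Submodule.pow_succ]; exact Ideal.mul_mem_mul hj hi))
      change (f : Coinduced k B I) (j * i * 1) = 0 at h1
      rwa [mul_one] at h1) hgJ hg0
    refine hjf ?_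
    have hmem : op j • f ∈ L ⊓ LinearMap.range (Submodule.liftQ _ φ hker) := by
      refine ⟨L.smul_mem _ hf, Submodule.Quotient.mk ⟨e a * d, h.mul_mem a d⟩,
        Subtype.ext ?_⟩
      rw [hd]
      refine Coinduced.ext fun x => ?_
      change g (e a * d * x) = g (d * x)
      rw [mul_assoc, h.apply_mul_left hg hgJ]
    rw [hL] at hmem
    exact hmem

/-- The factor `b` makes the condition stable under the action of `B`, so it cuts out the largest
submodule killed by all `e c` with `c ≰ a`. -/
theorem mem_nabla_iff (ord : PartialOrder ι) (E : ι → ModuleCat.{w} Bᵐᵒᵖ) (a : ι) (f : E a) :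
    f ∈ nabla ord (fun a => topRightIdeal (e a)) E a ↔
      ∀ c, ¬ ord.le c a → ∀ b : B, op (b * e c) • f = 0 := by
  let Z : Submodule Bᵐᵒᵖ (E a) :=
    { carrier := {f | ∀ c, ¬ ord.le c a → ∀ b : B, op (b * e c) • f = 0}
      add_mem' := fun hf hg c hc b => by rw [smul_add, hf c hc b, hg c hc b, add_zero]
      zero_mem' := fun _ _ _ => smul_zero _
      smul_mem' := fun r f hf c hc b => by
        have := hf c hc (r.unop * b)
        rwa [mul_assoc, op_mul, mul_smul, op_unop, smul_smul, mul_smul] at this }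
  suffices hZ : nabla ord (fun a => topRightIdeal (e a)) E a = Z by rw [hZ]; rfl
  refine le_antisymm (sSup_le fun N hN f hf c hc b => ?_) (le_sSup ?_)
  · rw [op_mul, mul_smul]
    exact h.hasFactorsIn_iff.1 hN c hc _ (N.smul_mem _ hf)
  · refine h.hasFactorsIn_iff.2 fun c hc f hf => ?_
    have := hf c hc 1
    rwa [one_mul] at this

end IsBasicIdempotents

end Coinduced

/-! ### Extending, transporting and truncating filtrations. -/

section Filtrations

variable {R : Type u} [Ring R] {I : Type z} {V : I → ModuleCat.{v} R}
  {N N' : Type v} [AddCommGroup N] [Module R N] [AddCommGroup N'] [Module R N']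

theorem nonempty_quotient_equiv_map (f : N →ₗ[R] N') {P Q : Submodule R N}
    (hQ : LinearMap.ker f ≤ Q) :
    Nonempty ((P ⧸ Q.submoduleOf P) ≃ₗ[R] (P.map f ⧸ (Q.map f).submoduleOf (P.map f))) := by
  set g := ((Q.map f).submoduleOf (P.map f)).mkQ ∘ₗ f.submoduleMap P
  have hg : Function.Surjective g :=
    (Submodule.mkQ_surjective _).comp (f.submoduleMap_surjective P)
  have hker : Q.submoduleOf P = LinearMap.ker g := by
    ext x
    rw [LinearMap.mem_ker, LinearMap.comp_apply, Submodule.mkQ_apply,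
      Submodule.Quotient.mk_eq_zero]
    change (x : N) ∈ Q ↔ f x ∈ Q.map f
    rw [← Submodule.mem_comap, Submodule.comap_map_eq_self hQ]
  exact ⟨(Submodule.quotEquivOfEq _ _ hker).trans (g.quotKerEquivOfSurjective hg)⟩

theorem Filtration.mult_ne_zero_iff (F : Filtration V N) (j : I) :
    F.mult j ≠ 0 ↔ ∃ a, F.label a = j := by
  rw [Filtration.mult, Nat.card_ne_zero, nonempty_subtype]
  exact and_iff_left inferInstance

theorem Filtration.exists_transport (F : Filtration V N) (E : N ≃ₗ[R] N') :
    ∃ F' : Filtration V N', ∀ a, ∃ a', F'.label a' = F.label a := by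
  refine ⟨⟨F.length, fun a => (F.sub a).map E.toLinearMap, F.label, ?_, ?_, fun a => ?_,
    fun a => ?_⟩, fun a => ⟨a, rfl⟩⟩
  · rw [F.sub_zero, Submodule.map_top, LinearEquiv.range]
  · rw [F.sub_last, Submodule.map_bot]
  · exact Submodule.map_mono (F.le a)
  · obtain ⟨i⟩ := F.iso a
    obtain ⟨j⟩ := nonempty_quotient_equiv_map E.toLinearMap (P := F.sub a.castSucc)
      (Q := F.sub a.succ) (by simp)
    exact ⟨j.symm.trans i⟩

theorem Filtration.nonempty_of_ker (F : Filtration V N') (f : N →ₗ[R] N')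
    (hf : Function.Surjective f) {j : I} (hj : Nonempty (LinearMap.ker f ≃ₗ[R] V j)) :
    Nonempty (Filtration V N) := by
  refine ⟨⟨F.length + 1, Fin.snoc (α := fun _ => Submodule R N) (fun a => (F.sub a).comap f) ⊥,
    Fin.snoc (α := fun _ => I) F.label j, ?_, Fin.snoc_last _ _, fun a => ?_, fun a => ?_⟩⟩
  · rw [← Fin.castSucc_zero, Fin.snoc_castSucc, F.sub_zero, Submodule.comap_top]
  · induction a using Fin.lastCases with
    | last => rw [Fin.succ_last, Fin.snoc_last]; exact bot_le
    | cast a =>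
      rw [Fin.succ_castSucc, Fin.snoc_castSucc, Fin.snoc_castSucc]
      exact Submodule.comap_mono (F.le a)
  · induction a using Fin.lastCases with
    | last =>
      rw [Fin.succ_last, Fin.snoc_last, Fin.snoc_castSucc, Fin.snoc_last, F.sub_last,
        Submodule.comap_bot]
      obtain ⟨i⟩ := hj
      exact ⟨(Submodule.quotEquivOfEqBot _ (by simp [Submodule.submoduleOf])).trans i⟩
    | cast a =>
      rw [Fin.succ_castSucc, Fin.snoc_castSucc, Fin.snoc_castSucc, Fin.snoc_castSucc]
      obtain ⟨i⟩ := F.iso a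
      obtain ⟨j⟩ := nonempty_quotient_equiv_map f (P := (F.sub a.castSucc).comap f)
        (Q := (F.sub a.succ).comap f) (LinearMap.ker_le_comap f)
      rw [Submodule.map_comap_eq_of_surjective hf, Submodule.map_comap_eq_of_surjective hf] at j
      exact ⟨j.trans i⟩

/-- Splits off the bottom term `K`, for the induction that determines the labels of an arbitrary
filtration. -/
theorem Filtration.exists_quotient (F : Filtration V N) (hF : F.length ≠ 0) :
    ∃ (K : Submodule R N) (c : I) (F' : Filtration V (N ⧸ K)), Nonempty (K ≃ₗ[R] V c) ∧
      ∀ a, F.label a = c ∨ ∃ a', F'.label a' = F.label a := by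
  obtain ⟨n, sub, label, h0, hlast, hle, hiso⟩ := F
  obtain ⟨n, rfl⟩ := Nat.exists_eq_succ_of_ne_zero hF
  set K := sub (Fin.last n).castSucc
  have hK : ∀ a : Fin (n + 1), K ≤ sub a.castSucc := fun a =>
    Fin.antitone_iff_succ_le.2 hle (Fin.castSucc_le_castSucc_iff.2 (Fin.le_last a))
  refine ⟨K, label (Fin.last n), ⟨n, fun a => (sub a.castSucc).map K.mkQ,
    fun a => label a.castSucc, ?_, ?_, fun a => ?_, fun a => ?_⟩, ?_, fun a => ?_⟩
  · rw [Fin.castSucc_zero, h0, Submodule.map_top, Submodule.range_mkQ]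
  · exact Submodule.mkQ_map_self K
  · exact Submodule.map_mono (hle a.castSucc)
  · obtain ⟨i⟩ := hiso a.castSucc
    obtain ⟨j⟩ := nonempty_quotient_equiv_map K.mkQ (P := sub a.castSucc.castSucc)
      (Q := sub a.succ.castSucc) (by rw [Submodule.ker_mkQ]; exact hK _)
    exact ⟨j.symm.trans i⟩
  · obtain ⟨i⟩ := hiso (Fin.last n)
    refine ⟨(Submodule.quotEquivOfEqBot _ ?_).symm.trans i⟩
    rw [Fin.succ_last, hlast]
    simp [Submodule.submoduleOf]
  · induction a using Fin.lastCases with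
    | last => exact Or.inl rfl
    | cast a => exact Or.inr ⟨a, rfl⟩

theorem Filtration.nonempty_of_subsingleton [Subsingleton N] : Nonempty (Filtration V N) :=
  ⟨⟨0, fun _ => ⊥, Fin.elim0, Subsingleton.elim _ _, rfl, fun a => a.elim0, fun a => a.elim0⟩⟩

theorem Filtration.subsingleton_of_subsingleton [Subsingleton N] (F : Filtration V N)
    (a : Fin F.length) : Subsingleton (V (F.label a)) := by
  obtain ⟨i⟩ := F.iso a
  have : Subsingleton (F.sub a.castSucc ⧸ (F.sub a.succ).submoduleOf (F.sub a.castSucc)) :=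
    (Submodule.mkQ_surjective _).subsingleton
  exact i.symm.toEquiv.subsingleton

theorem injective_of_equiv (E : N ≃ₗ[R] N') (h : Module.Injective R N') :
    Module.Injective R N := by
  refine ⟨fun X Y _ _ _ _ f hf g => ?_⟩
  obtain ⟨u, hu⟩ := h.out f hf (E.toLinearMap ∘ₗ g)
  exact ⟨E.symm.toLinearMap ∘ₗ u, fun x => by
    rw [LinearMap.comp_apply, hu]
    simp⟩

theorem injective_of_subsingleton [Subsingleton N] : Module.Injective R N :=
  ⟨fun _ _ _ _ _ _ _ _ _ => ⟨0, fun _ => Subsingleton.elim _ _⟩⟩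

end Filtrations

/-! ### Costandard modules and the criterion for left-strong quasi-heredity. -/

section Costandard

variable {k : Type w} [CommRing k] {B : Type w} [Ring B] [Algebra k B]
  {I : Type w} [AddCommGroup I] [Module k I]

instance : Module k (Coinduced k B I) := inferInstanceAs (Module k (B →ₗ[k] I))

instance : IsScalarTower k Bᵐᵒᵖ (Coinduced k B I) where
  smul_assoc r c f := Coinduced.ext fun x =>
    (congrArg f (smul_mul_assoc r c.unop x)).trans (map_smul f r _)

theorem Coinduced.isArtinian [IsArtinianRing k] [Module.Finite k B]
    (hI : IsMinimalCogenerator k I) : IsArtinian Bᵐᵒᵖ (Coinduced k B I) := by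
  have hfin : IsFiniteLength k B :=
    isFiniteLength_iff_isNoetherian_isArtinian.2 ⟨inferInstance, inferInstance⟩
  have hfin' : IsFiniteLength k (B →ₗ[k] I) := Module.length_ne_top_iff.1
    (ne_top_of_le_ne_top (Module.length_ne_top_iff.2 hfin) (hI.length_le_of_isFiniteLength hfin))
  have : IsArtinian k (Coinduced k B I) := (isFiniteLength_iff_isNoetherian_isArtinian.1 hfin').2
  exact isArtinian_of_tower k this

namespace IsBasicIdempotents

variable {ι : Type z} [Fintype ι] {e : ι → B} (h : IsBasicIdempotents e) (ord : PartialOrder ι)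
include h

omit [Fintype ι] h in
variable (k I e) in
/-- The injective hulls of the simple modules. -/
abbrev hull (a : ι) : ModuleCat.{w} Bᵐᵒᵖ := ModuleCat.of _ (dualOf k I (e a))

omit [Fintype ι] h in
variable (k I e) in
/-- The costandard submodules of the injective hulls. -/
abbrev costandard (a : ι) : Submodule Bᵐᵒᵖ (hull k I e a) :=
  nabla ord (fun a => topRightIdeal (e a)) (hull k I e) a

theorem costandard_eq_top {a : ι} (ha : ∀ c, ¬ ord.le c a → ∀ x, e c * x * e a = 0) :
    costandard k I e ord a = ⊤ := by
  refine (Submodule.eq_top_iff').2 fun f => (h.mem_nabla_iff ord _ a f).2 fun c hc b =>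
    Subtype.ext (Coinduced.ext fun x => ?_)
  change (f : Coinduced k B I) (b * e c * x) = 0
  rw [← f.2, mul_assoc, mul_assoc, ← mul_assoc (e c), ha c hc, mul_zero, map_zero]

/-- By `hcancel`, `x ↦ x p` embeds `B e_s` in `B e_a`. Its image is the trace of the `B e_c` with `c
≰ a`: `hgen` gives one inclusion, and `p = e_s p` with `s ≰ a` the other. Dualising gives a
surjection `θ` of hulls whose kernel is the annihilator of the trace, which is `∇(a)`. -/
theorem nonempty_quotient_costandard_equiv (hI : IsMinimalCogenerator k I) {a s : ι} {p : B}
    (hlt : ord.lt a s) (hsp : e s * p = p) (hpa : p * e a = p)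
    (hcancel : ∀ x, x * p = 0 → x * e s = 0)
    (hgen : ∀ c, ¬ ord.le c a → ∀ x, ∃ y, e c * x * e a = y * p) :
    Nonempty ((hull k I e a ⧸ costandard k I e ord a) ≃ₗ[Bᵐᵒᵖ] hull k I e s) := by
  set θ : dualOf k I (e a) →ₗ[Bᵐᵒᵖ] dualOf k I (e s) :=
    ((Coinduced.mulRight p).domRestrict _).codRestrict _ fun f x => by
      change (f : Coinduced k B I) (x * e s * p) = (f : Coinduced k B I) (x * p)
      rw [mul_assoc, hsp]
  have hθ : ∀ f x, (θ f : Coinduced k B I) x = (f : Coinduced k B I) (x * p) := fun _ _ => rfl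
  have hsurj : Function.Surjective θ := by
    rintro ⟨g, hg⟩
    have hle : LinearMap.ker (LinearMap.mulRight k p) ≤ LinearMap.ker (g : B →ₗ[k] I) := by
      intro x hx
      change g x = 0
      rw [← hg, hcancel x hx, map_zero]
    -- `g` descends to `B / ker(· p)`, which embeds in `B` through right multiplication by `p`;
    -- injectivity of `I` extends it to `B`.
    obtain ⟨f, hf⟩ := hI.injective.out
      ((LinearMap.ker (LinearMap.mulRight k p)).liftQ (LinearMap.mulRight k p) le_rfl)
      (LinearMap.ker_eq_bot.1 (Submodule.ker_liftQ_eq_bot' _ _ rfl))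
      ((LinearMap.ker (LinearMap.mulRight k p)).liftQ g hle)
    refine ⟨⟨LinearMap.comp f (LinearMap.mulRight k (e a)), fun x => congrArg f ?_⟩,
      Subtype.ext (Coinduced.ext fun x => ?_)⟩
    · change x * e a * e a = x * e a
      rw [mul_assoc, h.mul_self]
    · rw [hθ]
      change f (x * p * e a) = g x
      rw [mul_assoc, hpa]
      exact hf (Submodule.Quotient.mk x)
  have hker : costandard k I e ord a = LinearMap.ker θ := by
    ext f
    rw [h.mem_nabla_iff ord, LinearMap.mem_ker]
    constructor
    · intro hf
      refine Subtype.ext (Coinduced.ext fun x => ?_)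
      have h1 := congrArg (fun u : dualOf k I (e a) => (u : Coinduced k B I) p)
        (hf s ((ord.lt_iff_le_not_ge a s).1 hlt).2 x)
      change (f : Coinduced k B I) (x * e s * p) = 0 at h1
      rw [hθ]
      rwa [mul_assoc, hsp] at h1
    · intro hf c hc b
      refine Subtype.ext (Coinduced.ext fun x => ?_)
      obtain ⟨y, hy⟩ := hgen c hc x
      change (f : Coinduced k B I) (b * e c * x) = 0
      rw [← f.2, mul_assoc, mul_assoc, ← mul_assoc (e c), hy, ← mul_assoc, ← hθ, hf]
      rfl
  exact ⟨(Submodule.quotEquivOfEq _ _ hker).trans (θ.quotKerEquivOfSurjective hsurj)⟩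

theorem range_le_nabla (E : ι → ModuleCat.{w} Bᵐᵒᵖ) {a : ι}
    (f : topRightIdeal (e a) →ₗ[Bᵐᵒᵖ] E a) :
    LinearMap.range f ≤ nabla ord (fun a => topRightIdeal (e a)) E a := by
  rintro _ ⟨s, rfl⟩
  refine (h.mem_nabla_iff ord _ a _).2 fun c hc b => ?_
  rw [op_mul, mul_smul, ← map_smul, ← map_smul, h.smul_top_eq_zero, map_zero]
  rintro rfl
  exact hc (ord.le_refl _)

/-- A submodule of an injective hull of `S a` which is isomorphic to some costandard module is
the costandard module of index `a`. -/
theorem eq_nabla_of_equiv (E : ι → ModuleCat.{w} Bᵐᵒᵖ)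
    (f : ∀ a, topRightIdeal (e a) →ₗ[Bᵐᵒᵖ] E a) (hf : ∀ a, IsInjectiveHull (f a)) {a c : ι}
    [IsArtinian Bᵐᵒᵖ (E a)] (K : Submodule Bᵐᵒᵖ (E a))
    (i : K ≃ₗ[Bᵐᵒᵖ] nabla ord (fun a => topRightIdeal (e a)) E c) :
    c = a ∧ K = nabla ord (fun a => topRightIdeal (e a)) E a := by
  -- `K` contains a copy of `S c`, which meets `S a` because `S a` is essential in `E a`. An
  -- idempotent acting nontrivially on a common element identifies the two.
  have hca : c = a := by
    let g : topRightIdeal (e c) →ₗ[Bᵐᵒᵖ] E a := K.subtype ∘ₗ i.symm.toLinearMap ∘ₗ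
      (f c).codRestrict _ fun s => h.range_le_nabla ord E (f c) ⟨s, rfl⟩
    have hg : Function.Injective g := by
      refine K.injective_subtype.comp (i.symm.injective.comp fun x y hxy => ?_)
      exact (hf c).2.1 (congrArg Subtype.val hxy)
    have hne : LinearMap.range g ⊓ LinearMap.range (f a) ≠ ⊥ := fun h0 => by
      obtain ⟨s, hs⟩ := h.exists_smul_top_ne_zero c
      have h1 := (hf a).2.2 _ h0
      rw [LinearMap.range_eq_bot] at h1
      exact hs (hg (by rw [h1]; rfl))
    obtain ⟨x, ⟨⟨s, hs⟩, t, ht⟩, hx⟩ := Submodule.exists_mem_ne_zero_of_ne_bot hne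
    obtain ⟨d, hd⟩ := h.exists_smul_ne_zero hx
    have hcd : c = d := by
      by_contra hcd
      rw [← hs, ← map_smul, h.smul_top_eq_zero hcd, map_zero] at hd
      exact hd rfl
    have had : a = d := by
      by_contra had
      rw [← ht, ← map_smul, h.smul_top_eq_zero had, map_zero] at hd
      exact hd rfl
    rw [hcd, had]
  subst hca
  refine ⟨rfl, ?_⟩
  have hle : K ≤ nabla ord (fun a => topRightIdeal (e a)) E c := by
    intro x hx
    refine (h.mem_nabla_iff ord _ c x).2 fun d hd b => ?_
    have h1 := (h.mem_nabla_iff ord _ c _).1 (i ⟨x, hx⟩).2 d hd b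
    have h2 : op (b * e d) • i ⟨x, hx⟩ = 0 := Subtype.ext h1
    rw [← map_smul, LinearEquiv.map_eq_zero_iff] at h2
    exact congrArg Subtype.val h2
  refine le_antisymm hle fun x hx => ?_
  -- Now `K` is a submodule of `∇(c)` isomorphic to it, and an injective endomorphism of an artinian
  -- module is surjective.
  have hinj : Function.Injective (Submodule.inclusion hle ∘ₗ i.symm.toLinearMap) :=
    (Submodule.inclusion_injective hle).comp i.symm.injective
  obtain ⟨y, hy⟩ := IsArtinian.surjective_of_injective_endomorphism _ hinj ⟨x, hx⟩
  have : ((i.symm y : K) : E c) = x := congrArg Subtype.val hy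
  exact this ▸ (i.symm y).2

/-- The criterion for left-strongly quasi-hereditary algebras: the annihilator in `B e a` of the
costandard module of index `a` is zero or isomorphic to `B e s` for some `s > a`. -/
theorem isLeftStronglyQuasiHereditary [IsArtinianRing k] [Module.Finite k B]
    (hs : ∀ a, (∀ c, ¬ ord.le c a → ∀ x, e c * x * e a = 0) ∨
      ∃ s p, ord.lt a s ∧ e s * p = p ∧ p * e a = p ∧ (∀ x, x * p = 0 → x * e s = 0) ∧
        ∀ c, ¬ ord.le c a → ∀ x, ∃ y, e c * x * e a = y * p) :
    IsLeftStronglyQuasiHereditary B ord (fun a => topRightIdeal (e a)) := by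
  refine ⟨⟨k, _, _, inferInstance, inferInstance⟩, h.isCompleteSetOfSimples, ?_⟩
  obtain ⟨I, _, _, hI⟩ := exists_isMinimalCogenerator k
  choose f hf using h.exists_isInjectiveHull_dualOf hI
  have hart := Coinduced.isArtinian (B := B) hI
  have hcases : ∀ a, costandard k I e ord a = ⊤ ∨ ∃ s, ord.lt a s ∧
      Nonempty ((hull k I e a ⧸ costandard k I e ord a) ≃ₗ[Bᵐᵒᵖ] hull k I e s) := by
    intro a
    rcases hs a with ha | ⟨s, p, hlt, hsp, hpa, hcancel, hgen⟩
    · exact Or.inl (h.costandard_eq_top ord ha)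
    · exact Or.inr ⟨s, hlt,
        h.nonempty_quotient_costandard_equiv ord hI hlt hsp hpa hcancel hgen⟩
  have hwf : WellFounded fun a b : ι => ord.lt b a :=
    (wellFounded_gt : WellFounded ((· > ·) : ι → ι → Prop))
  refine ⟨hull k I e, f, hf, fun a => ⟨?_, ?_, ?_⟩⟩
  · induction a using hwf.induction with
    | _ a ih =>
      rcases hcases a with htop | ⟨s, hlt, ⟨i⟩⟩
      · have : Subsingleton (hull k I e a ⧸ costandard k I e ord a) :=
          Submodule.Quotient.subsingleton_iff.2 htop
        exact Filtration.nonempty_of_subsingleton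
      · obtain ⟨F⟩ := ih s hlt
        obtain ⟨F'⟩ := F.nonempty_of_ker (Submodule.mkQ _) (Submodule.mkQ_surjective _) (j := s)
          ⟨LinearEquiv.ofEq _ _ (Submodule.ker_mkQ _)⟩
        obtain ⟨F'', -⟩ := F'.exists_transport i.symm
        exact ⟨F''⟩
  · intro F j hj
    obtain ⟨l, rfl⟩ := (F.mult_ne_zero_iff j).1 hj
    clear hj
    induction a using hwf.induction with
    | _ a ih =>
      rcases hcases a with htop | ⟨s, hlt, ⟨i⟩⟩
      · have : Subsingleton (hull k I e a ⧸ costandard k I e ord a) :=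
          Submodule.Quotient.subsingleton_iff.2 htop
        have hsub := F.subsingleton_of_subsingleton l
        exfalso
        -- A filtration of the zero module has no factors, as every costandard module contains its
        -- nonzero simple module.
        obtain ⟨t, ht⟩ := h.exists_smul_top_ne_zero (F.label l)
        refine ht ((hf (F.label l)).2.1 ?_)
        rw [map_zero]
        exact congrArg Subtype.val (hsub.elim
          ⟨_, h.range_le_nabla ord (hull k I e) (f (F.label l)) ⟨_, rfl⟩⟩ 0)
      · obtain ⟨F', hF'⟩ := F.exists_transport i
        obtain ⟨l', hl'⟩ := hF' l
        obtain ⟨K, c, F'', ⟨iK⟩, hF''⟩ := F'.exists_quotient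
          (fun h0 => (Fin.cast h0 l').elim0)
        -- The bottom term is forced to be `∇(s)`, so the remaining labels come from a filtration of
        -- `E(s)/∇(s)`, to which the induction applies.
        obtain ⟨rfl, rfl⟩ := h.eq_nabla_of_equiv ord (hull k I e) f hf K iK
        rw [← hl']
        rcases hF'' l' with h1 | ⟨l'', h1⟩
        · rwa [h1]
        · rw [← h1]
          exact @lt_trans ι ord.toPreorder _ _ _ hlt (ih _ hlt F'' l'')
  · rcases hcases a with htop | ⟨s, hlt, ⟨i⟩⟩
    · have : Subsingleton (hull k I e a ⧸ costandard k I e ord a) :=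
        Submodule.Quotient.subsingleton_iff.2 htop
      exact injective_of_subsingleton
    · exact injective_of_equiv i (hf s).1

end IsBasicIdempotents

end Costandard

/-! ### Indecomposable modules of finite length and their radical maps. -/

section Indecomposable

variable {R : Type u} [Ring R] {X : Type v} {Y : Type w} [AddCommGroup X] [Module R X]
  [AddCommGroup Y] [Module R Y]

theorem isCompl_range_ker {f : X →ₗ[R] Y} {g : Y →ₗ[R] X} (h : Function.Bijective (g ∘ₗ f)) :
    IsCompl (LinearMap.range f) (LinearMap.ker g) := by
  refine IsCompl.of_eq (eq_bot_iff.2 ?_) (eq_top_iff.2 fun y _ => ?_)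
  · rintro _ ⟨⟨x, rfl⟩, hx⟩
    have : x = 0 := h.1 ((LinearMap.mem_ker.1 hx).trans (map_zero (g ∘ₗ f)).symm)
    rw [this, map_zero]
    exact Submodule.zero_mem _
  · obtain ⟨x, hx⟩ := h.2 (g y)
    refine Submodule.mem_sup.2 ⟨f x, ⟨x, rfl⟩, y - f x, ?_, add_sub_cancel _ _⟩
    rw [LinearMap.mem_ker, map_sub, sub_eq_zero]
    exact hx.symm

theorem IsIndecomposableModule.bijective_of_comp [Nontrivial X] (hY : IsIndecomposableModule R Y)
    {f : X →ₗ[R] Y} {g : Y →ₗ[R] X} (h : Function.Bijective (g ∘ₗ f)) : Function.Bijective f := by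
  have hc := isCompl_range_ker h
  have hf : Function.Injective f := fun x y hxy => h.1 (congrArg g hxy)
  refine ⟨hf, ?_⟩
  rcases hY.2 _ _ hc with h0 | h0
  · obtain ⟨x, hx⟩ := exists_ne (0 : X)
    exact absurd (hf ((LinearMap.congr_fun (LinearMap.range_eq_bot.1 h0) x).trans
      (map_zero f).symm)) hx
  · rw [h0] at hc
    exact LinearMap.range_eq_top.1 (eq_top_of_isCompl_bot hc)

/-- Fitting's lemma: for large `n` the module is the direct sum of the kernel and the range of `f ^
n`. -/
theorem IsIndecomposableModule.bijective_or_isNilpotent [IsNoetherian R X] [IsArtinian R X]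
    (hX : IsIndecomposableModule R X) (f : Module.End R X) :
    Function.Bijective f ∨ IsNilpotent f := by
  obtain ⟨n, hn, hc⟩ := ((Filter.eventually_ge_atTop 1).and
    (LinearMap.eventually_isCompl_ker_pow_range_pow f)).exists
  rcases hX.2 _ _ hc with h0 | h0
  · left
    refine IsArtinian.bijective_of_injective_endomorphism f ?_
    obtain ⟨n, rfl⟩ := Nat.exists_eq_succ_of_ne_zero (Nat.one_le_iff_ne_zero.1 hn)
    have hinj := LinearMap.ker_eq_bot.1 h0
    intro x y hxy
    refine hinj ?_
    rw [pow_succ, Module.End.mul_apply, Module.End.mul_apply, hxy]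
  · exact Or.inr ⟨n, LinearMap.range_eq_bot.1 h0⟩

theorem IsIndecomposableModule.bijective_or_bijective_of_add [IsNoetherian R X] [IsArtinian R X]
    (hX : IsIndecomposableModule R X) {f g : Module.End R X} (h : Function.Bijective (f + g)) :
    Function.Bijective f ∨ Function.Bijective g := by
  obtain ⟨w, hw⟩ := (Module.End.isUnit_iff _).2 h
  simp only [← Module.End.isUnit_iff] at *
  have hsum : (↑w⁻¹ : Module.End R X) * f + ↑w⁻¹ * g = 1 := by
    rw [← mul_add, ← hw, Units.inv_mul]
  rcases hX.bijective_or_isNilpotent (↑w⁻¹ * f) with hb | hn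
  · left
    rw [← Module.End.isUnit_iff] at hb
    exact (Units.isUnit_units_mul w⁻¹ f).1 hb
  · right
    have := hn.isUnit_one_sub
    rw [← hsum, add_sub_cancel_left] at this
    exact (Units.isUnit_units_mul w⁻¹ g).1 this

theorem IsIndecomposableModule.exists_bijective_of_sum [IsNoetherian R X] [IsArtinian R X]
    (hX : IsIndecomposableModule R X) {κ : Type*} (s : Finset κ) (f : κ → Module.End R X)
    (h : Function.Bijective ⇑(∑ i ∈ s, f i : Module.End R X)) : ∃ i ∈ s, Function.Bijective (f i) := by
  classical
  induction s using Finset.induction_on with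
  | empty =>
    have := hX.1
    obtain ⟨x, hx⟩ := exists_ne (0 : X)
    exact absurd (h.1 (by simp : (∑ i ∈ (∅ : Finset κ), f i : Module.End R X) x =
      (∑ i ∈ (∅ : Finset κ), f i : Module.End R X) 0)) hx
  | insert i s hi ih =>
    rw [Finset.sum_insert hi] at h
    rcases hX.bijective_or_bijective_of_add h with h1 | h1
    · exact ⟨i, Finset.mem_insert_self _ _, h1⟩
    · obtain ⟨j, hj, h2⟩ := ih h1
      exact ⟨j, Finset.mem_insert_of_mem hj, h2⟩

/-- An indecomposable direct summand of a finite direct sum of indecomposable modules is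
isomorphic to one of them. -/
theorem IsIndecomposableModule.exists_equiv_of_sum [IsNoetherian R X] [IsArtinian R X]
    (hX : IsIndecomposableModule R X) {κ : Type*} [Fintype κ] {Z : κ → Type*}
    [∀ i, AddCommGroup (Z i)] [∀ i, Module R (Z i)] (hZ : ∀ i, IsIndecomposableModule R (Z i))
    (α : ∀ i, Z i →ₗ[R] Y) (β : ∀ i, Y →ₗ[R] Z i) (hαβ : ∑ i, α i ∘ₗ β i = LinearMap.id)
    (f : X →ₗ[R] Y) (g : Y →ₗ[R] X) (hgf : g ∘ₗ f = LinearMap.id) :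
    ∃ i, Nonempty (X ≃ₗ[R] Z i) := by
  have hsum : ∑ i, (g ∘ₗ α i) ∘ₗ (β i ∘ₗ f) = (1 : Module.End R X) := by
    ext x
    have h1 := congrArg g (LinearMap.congr_fun hαβ (f x))
    have h2 := LinearMap.congr_fun hgf x
    simp only [LinearMap.sum_apply, LinearMap.comp_apply, LinearMap.id_apply, map_sum] at h1 h2
    rw [LinearMap.sum_apply]
    exact h1.trans h2
  obtain ⟨i, -, hi⟩ := hX.exists_bijective_of_sum Finset.univ
    (fun i => (g ∘ₗ α i) ∘ₗ (β i ∘ₗ f)) 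
    (by rw [hsum]; exact Function.bijective_id)
  have := hX.1
  exact ⟨i, ⟨LinearEquiv.ofBijective _ ((hZ i).bijective_of_comp hi)⟩⟩

theorem IsIndecomposableModule.congr (E : X ≃ₗ[R] Y) (hX : IsIndecomposableModule R X) :
    IsIndecomposableModule R Y := by
  refine ⟨have := hX.1; E.symm.toEquiv.nontrivial, fun P Q hPQ => ?_⟩
  have h1 : IsCompl (P.comap E.toLinearMap) (Q.comap E.toLinearMap) := by
    exact (Submodule.orderIsoMapComap E).symm.isCompl hPQ
  have h2 : ∀ P : Submodule R Y, P.comap E.toLinearMap = ⊥ → P = ⊥ := fun P hP =>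
    (map_eq_bot_iff (Submodule.orderIsoMapComap E).symm).1 hP
  exact (hX.2 _ _ h1).imp (h2 P) (h2 Q)

/-- A radical map from a nonzero module is not an isomorphism. -/
theorem IsRadicalMap.not_bijective [Nontrivial X] {f : X →ₗ[R] Y} (hf : IsRadicalMap f) :
    ¬ Function.Bijective f := by
  intro hb
  have := hf (LinearEquiv.ofBijective f hb).symm.toLinearMap
  have h0 : (LinearEquiv.ofBijective f hb).symm.toLinearMap ∘ₗ f = 1 :=
    LinearMap.ext fun x => (LinearEquiv.ofBijective f hb).symm_apply_apply x
  rw [h0, sub_self] at this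
  exact not_isUnit_zero this

theorem IsIndecomposableModule.isRadicalMap [IsNoetherian R X] [IsArtinian R X]
    (hX : IsIndecomposableModule R X) (hY : IsIndecomposableModule R Y)
    (hXY : IsEmpty (X ≃ₗ[R] Y)) (f : X →ₗ[R] Y) : IsRadicalMap f := by
  intro g
  have := hX.1
  refine ((hX.bijective_or_isNilpotent (g ∘ₗ f)).resolve_left fun hb => ?_).isUnit_one_sub
  exact hXY.elim (LinearEquiv.ofBijective f (hY.bijective_of_comp hb))

end Indecomposable

/-! ### Radical powers, Loewy length and hollow modules. -/

section Loewy

variable {R : Type u} [Ring R] {N : Type v} {N' : Type w} [AddCommGroup N] [Module R N]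
  [AddCommGroup N'] [Module R N']

theorem radPow_succ (n : ℕ) : radPow R N (n + 1) = Ring.jacobson R • radPow R N n := rfl

theorem map_radPow_le (f : N →ₗ[R] N') (n : ℕ) : (radPow R N n).map f ≤ radPow R N' n := by
  induction n with
  | zero => exact le_top
  | succ n ih =>
    rw [radPow_succ, Submodule.map_smul'']
    exact smul_mono_right _ ih

theorem map_radPow_of_surjective {f : N →ₗ[R] N'} (hf : Function.Surjective f) (n : ℕ) :
    (radPow R N n).map f = radPow R N' n := by
  induction n with
  | zero => exact (Submodule.map_top f).trans (LinearMap.range_eq_top.2 hf)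
  | succ n ih => rw [radPow_succ, Submodule.map_smul'', ih, radPow_succ]

theorem map_radPow_le_succ {f : N →ₗ[R] N'} (hf : LinearMap.range f ≤ radPow R N' 1) (n : ℕ) :
    (radPow R N n).map f ≤ radPow R N' (n + 1) := by
  induction n with
  | zero => exact (Submodule.map_top f).le.trans hf
  | succ n ih =>
    rw [radPow_succ, Submodule.map_smul'']
    exact smul_mono_right _ ih

theorem radPow_antitone : Antitone (radPow R N) :=
  antitone_nat_of_succ_le fun _ => Submodule.smul_le_right

theorem exists_radPow_eq_bot [IsNoetherian R N] [IsArtinian R N] : ∃ n, radPow R N n = ⊥ := by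
  obtain ⟨n, hn⟩ := IsArtinian.monotone_stabilizes ⟨fun n => OrderDual.toDual (radPow R N n),
    radPow_antitone⟩
  refine ⟨n, (IsNoetherian.noetherian (radPow R N n)).eq_bot_of_le_jacobson_smul ?_⟩
  have h1 : radPow R N n = radPow R N (n + 1) := hn (n + 1) n.le_succ
  exact h1.le

theorem radPow_loewyLength [IsNoetherian R N] [IsArtinian R N] :
    radPow R N (loewyLength R N) = ⊥ :=
  Nat.sInf_mem (s := {n | radPow R N n = ⊥}) exists_radPow_eq_bot

theorem loewyLength_le {n : ℕ} (h : radPow R N n = ⊥) : loewyLength R N ≤ n :=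
  Nat.sInf_le h

theorem loewyLength_pos [IsNoetherian R N] [IsArtinian R N] [Nontrivial N] :
    0 < loewyLength R N := by
  rw [Nat.pos_iff_ne_zero]
  intro h0
  have := radPow_loewyLength (R := R) (N := N)
  rw [h0] at this
  exact top_ne_bot this

/-- `N / J N` is a module over the semisimple ring `R / J`, hence has zero radical. -/
theorem jacobson_le_radPow_one [IsArtinianRing R] : Module.jacobson R N ≤ radPow R N 1 := by
  refine Module.jacobson_le_of_eq_bot ?_
  have htors : Module.IsTorsionBySet R (N ⧸ radPow R N 1) (Ring.jacobson R) :=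
    (Module.isTorsionBySet_quotient_iff _ _).2 fun x r hr =>
      Submodule.smul_mem_smul hr Submodule.mem_top
  let _ := htors.module
  have : IsSemisimpleModule R (N ⧸ radPow R N 1) :=
    (htors.semilinearMap.isSemisimpleModule_iff_of_bijective Function.bijective_id).2 inferInstance
  exact IsSemisimpleModule.jacobson_eq_bot _ _

variable (R N) in
/-- A module which is not the sum of two proper submodules. -/
def IsHollow : Prop := ∀ P Q : Submodule R N, P ⊔ Q = ⊤ → P = ⊤ ∨ Q = ⊤

theorem IsLocalModule.isHollow [Module.Finite R N] (h : IsLocalModule R N) : IsHollow R N := by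
  have hc : IsCoatom (Module.jacobson R N) := isSimpleModule_iff_isCoatom.1 h
  have hle : ∀ P : Submodule R N, P ≠ ⊤ → P ≤ Module.jacobson R N := fun P hP => by
    obtain ⟨C, hC, hPC⟩ := (eq_top_or_exists_le_coatom P).resolve_left hP
    have : Module.jacobson R N ≤ C := sInf_le hC
    exact hPC.trans (this.eq_or_lt.resolve_right fun hlt => hC.1 (hc.2 _ hlt)).ge
  intro P Q hPQ
  by_contra! hne
  exact hc.1 (eq_top_iff.2 (hPQ.ge.trans (sup_le (hle P hne.1) (hle Q hne.2))))

theorem IsHollow.of_surjective (h : IsHollow R N) {f : N →ₗ[R] N'} (hf : Function.Surjective f) :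
    IsHollow R N' := by
  intro P Q hPQ
  have h1 : P.comap f ⊔ Q.comap f = ⊤ := by
    refine eq_top_iff.2 fun x _ => ?_
    obtain ⟨p, hp, q, hq, hpq⟩ := Submodule.mem_sup.1 (hPQ.ge (Submodule.mem_top (x := f x)))
    obtain ⟨p, rfl⟩ := hf p
    refine Submodule.mem_sup.2 ⟨p, hp, x - p, ?_, add_sub_cancel _ _⟩
    rw [Submodule.mem_comap, map_sub, ← hpq, add_sub_cancel_left]
    exact hq
  have h2 : ∀ P : Submodule R N', P.comap f = ⊤ → P = ⊤ := fun P hP => by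
    rw [← Submodule.map_comap_eq_of_surjective hf P, hP, Submodule.map_top,
      LinearMap.range_eq_top.2 hf]
  exact (h _ _ h1).imp (h2 P) (h2 Q)

theorem IsHollow.isIndecomposableModule [Nontrivial N] (h : IsHollow R N) :
    IsIndecomposableModule R N := by
  refine ⟨inferInstance, fun P Q hPQ => ?_⟩
  rcases h P Q hPQ.sup_eq_top with rfl | rfl
  · exact Or.inr (eq_bot_of_top_isCompl hPQ)
  · exact Or.inl (eq_bot_of_isCompl_top hPQ)

/-- In a hollow module a proper submodule and a maximal one cannot span, so a proper image lies in
every maximal submodule. -/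
theorem IsHollow.range_le_radPow_one [IsArtinianRing R] (h : IsHollow R N') {f : N →ₗ[R] N'}
    (hf : ¬ Function.Surjective f) : LinearMap.range f ≤ radPow R N' 1 := by
  refine le_trans (le_sInf fun C hC => ?_) jacobson_le_radPow_one
  by_contra hle
  have hsup : LinearMap.range f ⊔ C = ⊤ := hC.2 _ (lt_of_le_of_ne le_sup_right fun hEq =>
    hle (by rw [hEq]; exact le_sup_left))
  exact (h _ _ hsup).elim (fun h1 => hf (LinearMap.range_eq_top.1 h1)) hC.1

end Loewy

/-! ### The summands of the Loewy sum as quotients of local modules. -/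

section Decomposition

variable {R : Type u} [Ring R]

theorem exists_projections {T : Type w} [AddCommGroup T] [Module R T] {ι : Type z} [Fintype ι]
    {X : ι → Submodule R T} (hind : iSupIndep X) (hsup : ⨆ a, X a = ⊤) :
    ∃ π : ∀ a, T →ₗ[R] X a, (∀ a (x : X a), π a x = x) ∧
      (∀ a c, a ≠ c → ∀ x : X c, π a x = 0) ∧ ∀ t, ∑ a, (π a t : T) = t := by
  classical
  set E := LinearEquiv.ofBijective (DirectSum.coeLinearMap X)
    (DirectSum.isInternal_submodule_of_iSupIndep_of_iSup_eq_top hind hsup)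
  have hE : ∀ a (x : X a), E.symm x = DirectSum.lof R ι (fun a => X a) a x := fun a x => by
    rw [LinearEquiv.symm_apply_eq]
    exact (DirectSum.coeLinearMap_lof X a x).symm
  refine ⟨fun a => DirectSum.component R ι (fun a => X a) a ∘ₗ E.symm.toLinearMap,
    fun a x => ?_, fun a c hac x => ?_, fun t => ?_⟩
  · rw [LinearMap.comp_apply, LinearEquiv.coe_coe, hE, DirectSum.component.lof_self]
  · rw [LinearMap.comp_apply, LinearEquiv.coe_coe, hE, DirectSum.component.of, dif_neg hac.symm]
  · conv_rhs => rw [← E.apply_symm_apply t]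
    refine Eq.symm ((DirectSum.coeLinearMap_eq_dfinsuppSum X (E.symm t)).trans ?_)
    rw [DFinsupp.sum_eq_sum_fintype _ fun _ => rfl]
    rfl

/-- The map `N / J^n N → N' / J^n N'` induced by a homomorphism. -/
def radQuotMap {N : Type v} {N' : Type w} [AddCommGroup N] [Module R N] [AddCommGroup N']
    [Module R N'] (f : N →ₗ[R] N') (n : ℕ) : (N ⧸ radPow R N n) →ₗ[R] (N' ⧸ radPow R N' n) :=
  Submodule.mapQ _ _ f (Submodule.map_le_iff_le_comap.1 (map_radPow_le f n))

theorem radQuotMap_mk {N : Type v} {N' : Type w} [AddCommGroup N] [Module R N] [AddCommGroup N']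
    [Module R N'] (f : N →ₗ[R] N') (n : ℕ) (x : N) :
    radQuotMap f n (Submodule.Quotient.mk x) = Submodule.Quotient.mk (f x) := rfl

theorem radPow_congr {N : Type v} {N' : Type w} [AddCommGroup N] [Module R N] [AddCommGroup N']
    [Module R N'] (E : N ≃ₗ[R] N') {n : ℕ} {x : N} :
    E x ∈ radPow R N' n ↔ x ∈ radPow R N n := by
  rw [← map_radPow_of_surjective (f := E.toLinearMap) E.surjective n]
  exact (Submodule.mem_map_equiv (e := E) _).trans (by rw [E.symm_apply_apply])

theorem mk_mem_radPow {N : Type v} [AddCommGroup N] [Module R N] {n i : ℕ} (h : n ≤ i) {x : N} :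
    (Submodule.Quotient.mk x : N ⧸ radPow R N i) ∈ radPow R (N ⧸ radPow R N i) n ↔
      x ∈ radPow R N n := by
  rw [← map_radPow_of_surjective (Submodule.mkQ_surjective (radPow R N i)) n,
    ← Submodule.mkQ_apply, ← Submodule.mem_comap, Submodule.comap_map_eq_self]
  rw [Submodule.ker_mkQ]
  exact radPow_antitone h

theorem loewyLength_le_of_equiv {N : Type v} {N' : Type w} [AddCommGroup N] [Module R N]
    [AddCommGroup N'] [Module R N'] {i : ℕ} (E : N' ≃ₗ[R] (N ⧸ radPow R N i)) :
    loewyLength R N' ≤ i := by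
  refine loewyLength_le (eq_bot_iff.2 fun x hx => ?_)
  obtain ⟨y, hy⟩ := Submodule.Quotient.mk_surjective _ (E x)
  have h1 := (radPow_congr E).2 hx
  rw [← hy, mk_mem_radPow le_rfl] at h1
  rw [(Submodule.Quotient.mk_eq_zero _).2 h1] at hy
  exact E.map_eq_zero_iff.1 hy.symm

/-- The modules `L / J^i L` for the local direct summands `L` of `M` are, up to isomorphism, the
indecomposable direct summands of `⊕ M / J^i M`. -/
theorem IsBasicModuleOf.exists_local_summands [IsArtinianRing R] {M : Type v} [AddCommGroup M]
    [Module R M] [Module.Finite R M] (hM : IsSemilocalModule R M) {T : Type w} [AddCommGroup T]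
    [Module R T] {ι : Type z} {X : ι → Submodule R T}
    (hX : IsBasicModuleOf R (LoewySum R M) X) :
    ∃ (κ : Type v) (_ : Finite κ) (L : κ → Submodule R M),
      (∀ l, IsHollow R (L l)) ∧
      (∀ a, ∃ l, ∃ i : Fin (loewyLength R M),
        Nonempty (X a ≃ₗ[R] (L l ⧸ radPow R (L l) (i + 1)))) ∧
      ∀ l, ∀ i : Fin (loewyLength R M), ∃ a,
        Nonempty (X a ≃ₗ[R] (L l ⧸ radPow R (L l) (i + 1))) := by
  classical
  obtain ⟨κ, L, hind, hsup, hloc⟩ := hM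
  have hnoeth : IsNoetherian R M := inferInstance
  have hhol : ∀ l, IsHollow R (L l) := fun l => (hloc l).isHollow
  have hnt : ∀ l, Nontrivial (L l) := fun l => by
    have : IsSimpleModule R (L l ⧸ Module.jacobson R (L l)) := hloc l
    have := IsSimpleModule.nontrivial R (L l ⧸ Module.jacobson R (L l))
    exact (Submodule.mkQ_surjective (Module.jacobson R (L l))).nontrivial
  have hfin : Finite κ :=
    WellFoundedGT.finite_of_iSupIndep hind fun l => (Submodule.nontrivial_iff_ne_bot).1 (hnt l)
  have := Fintype.ofFinite κ
  obtain ⟨π, hπ, -, hsum⟩ := exists_projections hind hsup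
  have hind' : ∀ s : κ × Fin (loewyLength R M),
      IsIndecomposableModule R (L s.1 ⧸ radPow R (L s.1) (s.2 + 1)) := fun s => by
    have : Nontrivial (L s.1 ⧸ radPow R (L s.1) (s.2 + 1)) := by
      refine Submodule.Quotient.nontrivial_iff.2 (ne_of_lt ?_)
      exact ((radPow_antitone (Nat.le_add_left 1 _)).trans (Ring.jacobson_smul_top_le R _)).trans_lt
        (Module.jacobson_lt_top R _)
    exact ((hhol s.1).of_surjective (Submodule.mkQ_surjective _)).isIndecomposableModule
  -- The maps `α` and `β` exhibit the Loewy sum as the direct sum of the indecomposable modules `L l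
  -- / J^(i+1) L l`, which is what the Krull–Schmidt argument `exists_equiv_of_sum` needs.
  let α : ∀ s : κ × Fin (loewyLength R M),
      (L s.1 ⧸ radPow R (L s.1) (s.2 + 1)) →ₗ[R] LoewySum R M := fun s =>
    LinearMap.single R (fun i : Fin (loewyLength R M) => M ⧸ radPow R M (i + 1)) s.2 ∘ₗ
      radQuotMap (L s.1).subtype _
  let β : ∀ s : κ × Fin (loewyLength R M),
      LoewySum R M →ₗ[R] (L s.1 ⧸ radPow R (L s.1) (s.2 + 1)) := fun s =>
    radQuotMap (π s.1) _ ∘ₗ LinearMap.proj s.2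
  have hβα : ∀ s, β s ∘ₗ α s = LinearMap.id := fun s => by
    refine LinearMap.ext fun x => ?_
    obtain ⟨x, rfl⟩ := Submodule.Quotient.mk_surjective _ x
    change radQuotMap (π s.1) _ (Pi.single (M := fun i : Fin (loewyLength R M) =>
      M ⧸ radPow R M (i + 1)) s.2 (radQuotMap (L s.1).subtype _ _) s.2) = _
    rw [Pi.single_eq_same, radQuotMap_mk, radQuotMap_mk, Submodule.subtype_apply, hπ]
    rfl
  have hαβ : ∑ s, α s ∘ₗ β s = LinearMap.id := by
    refine LinearMap.ext fun y => funext fun i => ?_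
    rw [LinearMap.sum_apply, Finset.sum_apply, Fintype.sum_prod_type]
    have h1 : ∀ l, ∑ j, (α (l, j) ∘ₗ β (l, j)) y i =
        radQuotMap (L l).subtype _ (radQuotMap (π l) _ (y i)) := fun l => by
      rw [Finset.sum_eq_single i (fun j _ hj => ?_) (fun h => absurd (Finset.mem_univ i) h)]
      · exact Pi.single_eq_same (M := fun i : Fin (loewyLength R M) =>
          M ⧸ radPow R M (i + 1)) i _
      · exact Pi.single_eq_of_ne (M := fun i : Fin (loewyLength R M) =>
          M ⧸ radPow R M (i + 1)) hj.symm _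
    rw [Finset.sum_congr rfl fun l _ => h1 l, LinearMap.id_apply]
    obtain ⟨x, hx⟩ := Submodule.Quotient.mk_surjective _ (y i)
    rw [← hx]
    refine Eq.trans ?_ (congrArg (Submodule.Quotient.mk (p := radPow R M (i + 1))) (hsum x))
    exact (map_sum (Submodule.mkQ (radPow R M (i + 1))) _ _).symm
  refine ⟨κ, hfin, L, hhol, fun a => ?_, fun l i => ?_⟩
  · obtain ⟨Y, Z, hYZ, ⟨E⟩⟩ := hX.summand a
    have : IsNoetherian R (X a) := isNoetherian_of_linearEquiv E.symm
    have : IsArtinian R (X a) := isArtinian_of_linearEquiv E.symm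
    obtain ⟨s, hs⟩ := (hX.indecomposable a).exists_equiv_of_sum hind' α β hαβ
      (Y.subtype ∘ₗ E.toLinearMap) (E.symm.toLinearMap ∘ₗ Y.projectionOnto Z hYZ) (by
        ext x
        simp)
    exact ⟨s.1, s.2, hs⟩
  · have hb : Function.Bijective (β (l, i) ∘ₗ α (l, i)) := by
      rw [hβα]; exact Function.bijective_id
    have hinj : Function.Injective (α (l, i)) := fun x y hxy => hb.1 (congrArg (β (l, i)) hxy)
    set F := LinearEquiv.ofInjective (α (l, i)) hinj
    obtain ⟨a, ⟨E⟩⟩ := hX.complete _ _ (isCompl_range_ker hb) ((hind' (l, i)).congr F)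
    exact ⟨a, ⟨E.trans F.symm⟩⟩

/-- If `X a ≅ L / J^i L` has Loewy length `n`, dividing by its last nonzero radical power gives `L /
J^(n-1) L`, which is again in the list. -/
theorem IsBasicModuleOf.structure_of_isSemilocal [IsArtinianRing R] {M : Type v} [AddCommGroup M]
    [Module R M] [Module.Finite R M] (hM : IsSemilocalModule R M) {T : Type w} [AddCommGroup T]
    [Module R T] {ι : Type z} {X : ι → Submodule R T}
    (hX : IsBasicModuleOf R (LoewySum R M) X) :
    Finite ι ∧ ∀ a, Module.Finite R (X a) ∧ IsHollow R (X a) ∧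
      loewyLength R (X a) ≤ loewyLength R M ∧
      (2 ≤ loewyLength R (X a) → ∃ (s : ι) (f : X a →ₗ[R] X s), Function.Surjective f ∧
        LinearMap.ker f = radPow R (X a) (loewyLength R (X a) - 1)) := by
  obtain ⟨κ, _, L, hhol, hex, hex'⟩ := hX.exists_local_summands hM
  choose l i E using hex
  refine ⟨?_, fun a => ?_⟩
  · refine Finite.of_injective (fun a => (l a, i a)) fun a c hac => hX.not_iso a c ?_
    obtain ⟨E₁⟩ := E a
    obtain ⟨E₂⟩ := E c
    obtain ⟨h1, h2⟩ := Prod.mk.inj hac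
    rw [← h1, ← h2] at E₂
    exact ⟨E₁.trans E₂.symm⟩
  · obtain ⟨Ea⟩ := E a
    have hle := loewyLength_le_of_equiv Ea
    refine ⟨Module.Finite.equiv Ea.symm,
      (hhol (l a)).of_surjective (f := Ea.symm.toLinearMap ∘ₗ Submodule.mkQ _)
        (Ea.symm.surjective.comp (Submodule.mkQ_surjective _)), by omega, fun h2 => ?_⟩
    set n := loewyLength R (X a)
    -- The index `i` stands for the exponent `i + 1`, so `n - 2` yields the quotient by `J^(n-1)`;
    -- this is where `n ≥ 2` enters.
    obtain ⟨s, ⟨Es⟩⟩ := hex' (l a) ⟨n - 2, by omega⟩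
    have hn : n - 2 + 1 = n - 1 := by omega
    rw [Fin.val_mk, hn] at Es
    have hanti : radPow R (L (l a)) (i a + 1) ≤ radPow R (L (l a)) (n - 1) :=
      radPow_antitone (by omega)
    refine ⟨s, Es.symm.toLinearMap ∘ₗ Submodule.factor hanti ∘ₗ Ea.toLinearMap,
      Es.symm.surjective.comp ((Submodule.factor_surjective hanti).comp Ea.surjective), ?_⟩
    ext x
    obtain ⟨y, hy⟩ := Submodule.Quotient.mk_surjective _ (Ea x)
    rw [LinearMap.mem_ker, LinearMap.comp_apply, LinearMap.comp_apply, LinearEquiv.coe_coe,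
      LinearEquiv.coe_coe, LinearEquiv.map_eq_zero_iff, ← radPow_congr Ea, ← hy,
      mk_mem_radPow (by omega)]
    exact Submodule.Quotient.mk_eq_zero _

end Decomposition

/-! ### Maps between summands and the ADR order. -/

section Layers

variable {R : Type u} [Ring R] {T : Type w} [AddCommGroup T] [Module R T] {ι : Type z}
  {X : ι → Submodule R T}

/-- A surjection from a member of least length onto another member is bijective by length, hence not
radical. -/
theorem noSurj_nonempty (hfin : ∀ a, IsFiniteLength R (X a)) (hnt : ∀ a, Nontrivial (X a))
    {s : Set ι} (hs : s.Nonempty) : (noSurj X s).Nonempty := by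
  obtain ⟨x, hx, hmin⟩ := WellFounded.has_min
    (InvImage.wf (fun a => Module.length R (X a)) wellFounded_lt) s hs
  refine ⟨x, hx, fun y hy ⟨f, hf, hsurj⟩ => ?_⟩
  have := hnt x
  refine hf.not_bijective ⟨LinearMap.ker_eq_bot.1 ?_, hsurj⟩
  have hlen := Module.length_eq_add_of_exact (LinearMap.ker f).subtype f
    (Submodule.injective_subtype _) hsurj (LinearMap.exact_subtype_ker_map f)
  have hle : Module.length R (X x) ≤ Module.length R (X y) := not_lt.1 (hmin y hy)
  have hy : Module.length R (X y) ≠ ⊤ := Module.length_ne_top_iff.2 (hfin y)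
  rw [hlen] at hle
  have h0 : Module.length R (LinearMap.ker f) = 0 := by
    have h1 : Module.length R (LinearMap.ker f) + Module.length R (X y) ≤
      0 + Module.length R (X y) := by rwa [zero_add]
    exact nonpos_iff_eq_zero.1 ((ENat.add_le_add_iff_right hy).1 h1)
  have := Module.length_eq_zero_iff.1 h0
  exact (Submodule.subsingleton_iff_eq_bot).1 this

/-- Each removal takes away a nonempty set, so a finite layer is exhausted and every index is
removed at some stage. -/
theorem exists_mem_layer [Finite ι] (hfin : ∀ a, IsFiniteLength R (X a))
    (hnt : ∀ a, Nontrivial (X a)) {m i : ℕ} {a : ι} (ha : loewyLength R (X a) + i = m) :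
    ∃ j, a ∈ layer X m i j := by
  by_contra! hne
  have hmem : ∀ j, a ∈ layerRest X m i j := fun j => by
    induction j with
    | zero => exact ha
    | succ j ih => exact ⟨ih, hne j⟩
  have hcard : ∀ j, (layerRest X m i j).ncard + j ≤ (layerRest X m i 0).ncard := fun j => by
    induction j with
    | zero => exact le_rfl
    | succ j ih =>
      have hlt : (layerRest X m i (j + 1)).ncard < (layerRest X m i j).ncard := by
        obtain ⟨x, hx⟩ := noSurj_nonempty hfin hnt ⟨a, hmem j⟩
        exact Set.ncard_lt_ncard ⟨Set.sdiff_subset, fun hsub => (hsub hx.1).2 hx⟩ (Set.toFinite _)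
      omega
  have h1 := hcard ((layerRest X m i 0).ncard + 1)
  omega

/-- A homomorphism `X a → X c` with `c ≰ a` in the ADR order annihilates the last nonzero
radical power of `X a`. -/
theorem radPow_le_ker_of_not_le [IsArtinianRing R] [Finite ι] (hX : ∀ a, Module.Finite R (X a))
    (hind : ∀ a, IsIndecomposableModule R (X a))
    (hiso : ∀ a b, Nonempty (X a ≃ₗ[R] X b) → a = b) (hhol : ∀ a, IsHollow R (X a)) {m : ℕ}
    (hm : ∀ a, loewyLength R (X a) ≤ m) {a c : ι} (hca : ¬ (adrOrder X m).le c a)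
    (g : X a →ₗ[R] X c) :
    radPow R (X a) (loewyLength R (X a) - 1) ≤ LinearMap.ker g := by
  have hnt : ∀ a, Nontrivial (X a) := fun a => (hind a).1
  have hfin : ∀ a, IsFiniteLength R (X a) := fun a =>
    isFiniteLength_iff_isNoetherian_isArtinian.2 ⟨inferInstance, inferInstance⟩
  have hne : a ≠ c := fun h => hca (Or.inl h.symm)
  obtain ⟨j, hj⟩ := exists_mem_layer hfin hnt (X := X) (m := m)
    (i := m - loewyLength R (X a)) (a := a) (Nat.add_sub_of_le (hm a))
  obtain ⟨j', hj'⟩ := exists_mem_layer hfin hnt (X := X) (m := m)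
    (i := m - loewyLength R (X c)) (a := c) (Nat.add_sub_of_le (hm c))
  have hlex : ¬ (m - loewyLength R (X c) < m - loewyLength R (X a) ∨
      m - loewyLength R (X c) = m - loewyLength R (X a) ∧ j' < j) := fun h =>
    hca (Or.inr ⟨_, _, _, _, hj', hj, h⟩)
  have hma := hm a
  have hmc := hm c
  have hpos := loewyLength_pos (R := R) (N := X a)
  rw [← Submodule.comap_bot, ← Submodule.map_le_iff_le_comap,
    ← radPow_loewyLength (R := R) (N := X c)]
  rcases lt_or_ge (loewyLength R (X c)) (loewyLength R (X a)) with hlt | hge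
  · exact (map_radPow_le g _).trans (radPow_antitone (by omega))
  -- A strictly longer `X c` would give `c < a`, so the lengths agree. Then `c` is still present
  -- when `a` is removed, which rules out a surjection.
  · have heq : m - loewyLength R (X c) = m - loewyLength R (X a) := by omega
    rw [heq] at hj' hlex
    have hcmem : c ∈ layerRest X m (m - loewyLength R (X a)) j :=
      layerRest_anti X m _ (by omega) hj'.1
    have hnsurj : ¬ Function.Surjective g := fun hs => hj.2 c hcmem ⟨g, (hind a).isRadicalMap
      (hind c) ⟨fun E => hne (hiso a c ⟨E⟩)⟩ g, hs⟩
    exact (map_radPow_le_succ ((hhol c).range_le_radPow_one hnsurj) _).trans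
      (radPow_antitone (by omega))

theorem adrOrder_lt_of_loewyLength_lt [IsArtinianRing R] [Finite ι]
    (hX : ∀ a, Module.Finite R (X a)) (hnt : ∀ a, Nontrivial (X a)) {m : ℕ}
    (hm : ∀ a, loewyLength R (X a) ≤ m) {a s : ι}
    (hlt : loewyLength R (X s) < loewyLength R (X a)) : (adrOrder X m).lt a s := by
  have hfin : ∀ a, IsFiniteLength R (X a) := fun a =>
    isFiniteLength_iff_isNoetherian_isArtinian.2 ⟨inferInstance, inferInstance⟩
  obtain ⟨j, hj⟩ := exists_mem_layer hfin hnt (X := X) (m := m)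
    (i := m - loewyLength R (X a)) (a := a) (Nat.add_sub_of_le (hm a))
  obtain ⟨j', hj'⟩ := exists_mem_layer hfin hnt (X := X) (m := m)
    (i := m - loewyLength R (X s)) (a := s) (Nat.add_sub_of_le (hm s))
  have := hm a
  exact ⟨_, _, _, _, hj, hj', Or.inl (by omega)⟩

end Layers

/-! ### The endomorphism algebra. -/

section Endomorphisms

theorem mem_jacobson_of_forall_isNilpotent {B : Type w} [Ring B] {x : B}
    (h : ∀ b, IsNilpotent (b * x)) : x ∈ Ring.jacobson B := by
  rw [← Ideal.jacobson_bot, Ideal.mem_jacobson_iff]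
  intro y
  obtain ⟨u, hu⟩ := (h y).isUnit_one_add
  refine ⟨↑u⁻¹, ?_⟩
  have h1 : (↑u⁻¹ : B) * (1 + y * x) = 1 := by rw [← hu, Units.inv_mul]
  rw [Ideal.mem_bot, ← h1]
  noncomm_ring

theorem eq_zero_of_idem_of_mem_jacobson {B : Type w} [Ring B] {e : B} (he : e * e = e)
    (h : e ∈ Ring.jacobson B) : e = 0 := by
  rw [← Ideal.jacobson_bot, Ideal.mem_jacobson_iff] at h
  obtain ⟨z, hz⟩ := h (-1)
  rw [Ideal.mem_bot, mul_neg_one, sub_eq_zero] at hz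
  have h1 := congrArg (· * e) hz
  simp only [add_mul, neg_mul, mul_assoc, he, one_mul, neg_add_cancel] at h1
  exact h1.symm

variable {R : Type u} [Ring R] {T : Type w} [AddCommGroup T] [Module R T] {ι : Type z}
  {X : ι → Submodule R T}

/-- Nilpotency survives cyclic rotation: `(b s w)^(n+1) = b s (w b s)^n w`. Radical membership can
thus be tested in `End Y`. -/
theorem comp_mem_jacobson {Y : Type v} [AddCommGroup Y] [Module R Y] (s : Y →ₗ[R] T)
    (w : T →ₗ[R] Y) (h : ∀ b : Module.End R T, IsNilpotent (w ∘ₗ b ∘ₗ s : Module.End R Y)) :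
    (s ∘ₗ w : Module.End R T) ∈ Ring.jacobson (Module.End R T) := by
  refine mem_jacobson_of_forall_isNilpotent fun b => ?_
  obtain ⟨n, hn⟩ := h b
  have key : ∀ n, (b * (s ∘ₗ w : Module.End R T)) ^ (n + 1) =
      b ∘ₗ s ∘ₗ ((w ∘ₗ b ∘ₗ s : Module.End R Y) ^ n) ∘ₗ w := fun n => by
    induction n with
    | zero => simp only [zero_add, pow_one, pow_zero]; rfl
    | succ n ih => rw [pow_succ, ih, pow_succ]; rfl
  refine ⟨n + 1, ?_⟩
  rw [key, hn]
  ext t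
  simp

theorem exists_comp_eq_of_ker_le {N₁ N₂ N₃ : Type*} [AddCommGroup N₁] [Module R N₁]
    [AddCommGroup N₂] [Module R N₂] [AddCommGroup N₃] [Module R N₃] {f : N₁ →ₗ[R] N₂}
    (hf : Function.Surjective f) {g : N₁ →ₗ[R] N₃} (h : LinearMap.ker f ≤ LinearMap.ker g) :
    ∃ g' : N₂ →ₗ[R] N₃, ∀ x, g' (f x) = g x := by
  refine ⟨(LinearMap.ker f).liftQ g h ∘ₗ (f.quotKerEquivOfSurjective hf).symm.toLinearMap,
    fun x => ?_⟩
  have : (f.quotKerEquivOfSurjective hf).symm (f x) = Submodule.Quotient.mk x := by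
    rw [LinearEquiv.symm_apply_eq]
    rfl
  rw [LinearMap.comp_apply, LinearEquiv.coe_coe, this]
  rfl

/-- The corner at `a` is `End (X a)`, where Fitting's lemma applies. A round trip from `X a` through
a non-isomorphic `X c` is never bijective, hence nilpotent. -/
theorem isBasicIdempotents_of_projections [Fintype ι] (hfin : ∀ a, IsFiniteLength R (X a))
    (hind : ∀ a, IsIndecomposableModule R (X a))
    (hiso : ∀ a b, Nonempty (X a ≃ₗ[R] X b) → a = b) {π : ∀ a, T →ₗ[R] X a}
    (hπ : ∀ a (x : X a), π a x = x) (hπ' : ∀ a c, a ≠ c → ∀ x : X c, π a x = 0)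
    (hsum : ∀ t, ∑ a, (π a t : T) = t) :
    IsBasicIdempotents (fun a => ((X a).subtype ∘ₗ π a : Module.End R T)) where
  idem a := LinearMap.ext fun t => congrArg Subtype.val (hπ a (π a t))
  ortho a c hac := LinearMap.ext fun t => by
    change ((π a (π c t) : X a) : T) = 0
    rw [hπ' a c hac, Submodule.coe_zero]
  complete := LinearMap.ext fun t => by
    rw [LinearMap.sum_apply]
    exact hsum t
  mem_or_exists a x := by
    obtain ⟨_, _⟩ := isFiniteLength_iff_isNoetherian_isArtinian.1 (hfin a)
    set u : Module.End R (X a) := π a ∘ₗ x ∘ₗ (X a).subtype with hu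
    by_cases hb : Function.Bijective u
    · right
      refine ⟨(X a).subtype ∘ₗ (LinearEquiv.ofBijective u hb).symm.toLinearMap ∘ₗ π a,
        LinearMap.ext fun t => ?_⟩
      set y := (LinearEquiv.ofBijective u hb).symm (π a t)
      have hy : u y = π a t := (LinearEquiv.ofBijective u hb).apply_symm_apply (π a t)
      change ((π a (x (π a (y : T))) : X a) : T) = π a t
      rw [hπ]
      exact congrArg Subtype.val hy
    · left
      refine comp_mem_jacobson (X a).subtype (u ∘ₗ π a) fun b => ?_
      refine ((hind a).bijective_or_isNilpotent _).resolve_left fun hb' => hb ?_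
      exact IsNoetherian.bijective_of_surjective_endomorphism u fun y => by
        obtain ⟨x, hx⟩ := hb'.2 y
        exact ⟨_, hx⟩
  mul_mul_mem a c x hac := by
    obtain ⟨_, _⟩ := isFiniteLength_iff_isNoetherian_isArtinian.1 (hfin a)
    refine comp_mem_jacobson (X a).subtype ((π a ∘ₗ x ∘ₗ (X c).subtype) ∘ₗ π c) fun b => ?_
    have := (hind a).1
    refine ((hind a).bijective_or_isNilpotent _).resolve_left fun hb => hac (hiso a c ?_)
    exact ⟨LinearEquiv.ofBijective _ ((hind c).bijective_of_comp
      (f := π c ∘ₗ b ∘ₗ (X a).subtype) (g := π a ∘ₗ x ∘ₗ (X c).subtype) hb)⟩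
  notMem a hmem := by
    have := (hind a).1
    obtain ⟨x, hx⟩ := exists_ne (0 : X a)
    have h0 := eq_zero_of_idem_of_mem_jacobson
      (LinearMap.ext fun t => congrArg Subtype.val (hπ a (π a t))) hmem
    have h1 : ((π a x : X a) : T) = 0 := LinearMap.congr_fun h0 x
    rw [hπ] at h1
    exact hx (Subtype.ext h1)

/-- The endomorphism algebra of a finite direct sum of indecomposable hollow modules which is
closed under the formation of the quotients by the last nonzero radical powers. -/
theorem isLeftStronglyQuasiHereditary_end [IsArtinianRing R] [Finite ι]
    {k : Type w} [CommRing k] [Algebra k (Module.End R T)] [IsArtinianRing k]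
    [Module.Finite k (Module.End R T)] (hindep : iSupIndep X) (hsup : ⨆ a, X a = ⊤)
    (hX : ∀ a, Module.Finite R (X a)) (hind : ∀ a, IsIndecomposableModule R (X a))
    (hiso : ∀ a b, Nonempty (X a ≃ₗ[R] X b) → a = b) (hhol : ∀ a, IsHollow R (X a)) {m : ℕ}
    (hm : ∀ a, loewyLength R (X a) ≤ m)
    (hquot : ∀ a, 2 ≤ loewyLength R (X a) → ∃ (s : ι) (f : X a →ₗ[R] X s),
      Function.Surjective f ∧ LinearMap.ker f = radPow R (X a) (loewyLength R (X a) - 1)) :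
    IsLeftStronglyQuasiHereditary (Module.End R T) (adrOrder X m) (fun a => topHom (X a)) := by
  have := Fintype.ofFinite ι
  obtain ⟨π, hπ, hπ', hsum⟩ := exists_projections hindep hsup
  have hnt : ∀ a, Nontrivial (X a) := fun a => (hind a).1
  have h := isBasicIdempotents_of_projections (fun a =>
    isFiniteLength_iff_isNoetherian_isArtinian.2 ⟨inferInstance, inferInstance⟩) hind hiso hπ hπ'
    hsum
  have htop : ∀ a, homInto (X a) =
      rightIdeal ((X a).subtype ∘ₗ π a : Module.End R T) := fun a => by
    ext b
    refine ⟨fun hb => LinearMap.ext fun t => congrArg Subtype.val (hπ a ⟨b t, hb t⟩),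
      fun hb t => ?_⟩
    rw [← (hb : _ = b)]
    exact (π a (b t)).2
  have hS : (fun a => topHom (X a)) =
      fun a => topRightIdeal ((X a).subtype ∘ₗ π a : Module.End R T) :=
    funext fun a => congrArg (fun L : Submodule (Module.End R T)ᵐᵒᵖ (Module.End R T) =>
      ModuleCat.of (Module.End R T)ᵐᵒᵖ (L ⧸ Module.jacobson (Module.End R T)ᵐᵒᵖ L)) (htop a)
  rw [hS]
  refine h.isLeftStronglyQuasiHereditary (k := k) (adrOrder X m) fun a => ?_
  have key : ∀ c, ¬ (adrOrder X m).le c a → ∀ g : X a →ₗ[R] X c,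
      radPow R (X a) (loewyLength R (X a) - 1) ≤ LinearMap.ker g := fun c hc =>
    radPow_le_ker_of_not_le hX hind hiso hhol hm hc
  have hpos := loewyLength_pos (R := R) (N := X a)
  rcases Nat.lt_or_ge (loewyLength R (X a)) 2 with h1 | h2
  -- In Loewy length one the last nonzero radical power is the whole module, so all maps to `X c`
  -- with `c ≰ a` vanish.
  · left
    intro c hc x
    have hg := key c hc (π c ∘ₗ x ∘ₗ (X a).subtype)
    have h0 : loewyLength R (X a) - 1 = 0 := by omega
    rw [h0] at hg
    refine LinearMap.ext fun t => congrArg Subtype.val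
      (hg (Submodule.mem_top (x := π a t)) : π c (x (π a t)) = 0)
  · right
    obtain ⟨s, f, hf, hker⟩ := hquot a h2
    -- Here `p` is the projection onto `X s` viewed in `End T`. Its surjectivity gives right
    -- cancellation, and factoring maps through `f` gives the generation condition.
    refine ⟨s, (X s).subtype ∘ₗ f ∘ₗ π a, ?_, ?_, ?_, fun x hx => ?_, fun c hc x => ?_⟩
    · refine adrOrder_lt_of_loewyLength_lt hX hnt hm (lt_of_le_of_lt (loewyLength_le
        (n := loewyLength R (X a) - 1) ?_) (by omega))
      rw [← map_radPow_of_surjective hf, ← hker, eq_bot_iff,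
        Submodule.map_le_iff_le_comap]
      exact le_rfl
    · exact LinearMap.ext fun t => congrArg Subtype.val (hπ s (f (π a t)))
    · exact LinearMap.ext fun t => congrArg (fun y => ((f y : X s) : T)) (hπ a (π a t))
    · refine LinearMap.ext fun t => ?_
      obtain ⟨y, hy⟩ := hf (π s t)
      have h1 : x (f (π a y) : X s) = 0 := LinearMap.congr_fun hx (y : T)
      change x (π s t) = 0
      rw [← hy, ← h1, hπ]
    · obtain ⟨g, hg⟩ := exists_comp_eq_of_ker_le hf
        (hker.le.trans (key c hc (π c ∘ₗ x ∘ₗ (X a).subtype)))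
      refine ⟨(X c).subtype ∘ₗ g ∘ₗ π s, LinearMap.ext fun t => ?_⟩
      change ((π c (x (π a t)) : X c) : T) = g (π s (f (π a t) : X s))
      rw [hπ, hg]
      rfl

/-- The endomorphism ring of a finitely generated module over an artin algebra is finite over its
center, which is artinian. -/
theorem exists_artinian_finite_end {k : Type v} [CommRing k] [IsArtinianRing k] [Algebra k R]
    [Module.Finite k R] [Module.Finite R T] :
    ∃ (k' : Type w) (_ : CommRing k') (_ : Algebra k' (Module.End R T)),
      IsArtinianRing k' ∧ Module.Finite k' (Module.End R T) := by
  let _ : Module k T := Module.compHom T (algebraMap k R)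
  have : IsScalarTower k R T := IsScalarTower.of_algebraMap_smul fun _ _ => rfl
  have : SMulCommClass R k T := IsScalarTower.to_smulCommClass'
  have : Module.Finite k T := Module.Finite.trans R T
  have hnoeth : IsNoetherian k (T →ₗ[k] T) := by
    obtain ⟨n, p, hp⟩ := Module.Finite.exists_fin' k T
    exact isNoetherian_of_injective (LinearMap.lcomp k T p) fun f g hfg => LinearMap.ext fun t => by
      obtain ⟨y, rfl⟩ := hp t
      exact LinearMap.congr_fun hfg y
  have hfinEnd : IsNoetherian k (Module.End R T) := isNoetherian_of_injective
    ({ toFun := fun f => f.restrictScalars k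
       map_add' := fun _ _ => rfl
       map_smul' := fun _ _ => rfl } : Module.End R T →ₗ[k] (T →ₗ[k] T))
    (LinearMap.restrictScalars_injective k)
  -- The centre replaces `k` because, unlike `k`, it lives in the universe of `T`; being finite over
  -- `k`, it is artinian.
  have : IsNoetherian k (Subalgebra.center k (Module.End R T)) :=
    isNoetherian_submodule' (Subalgebra.toSubmodule (Subalgebra.center k (Module.End R T)))
  have hart : IsArtinian k (Subalgebra.center k (Module.End R T)) := inferInstance
  let alg : Algebra (Subalgebra.center k (Module.End R T)) (Module.End R T) :=
    RingHom.toAlgebra' (Subalgebra.center k (Module.End R T)).val.toRingHom fun c x =>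
      (Subalgebra.mem_center_iff.1 c.2 x).symm
  have : IsScalarTower k (Subalgebra.center k (Module.End R T)) (Module.End R T) :=
    IsScalarTower.of_algebraMap_eq fun _ => rfl
  have hfin : Module.Finite (Subalgebra.center k (Module.End R T)) (Module.End R T) :=
    Module.Finite.of_restrictScalars_finite k _ _
  exact ⟨Subalgebra.center k (Module.End R T), inferInstance, alg,
    isArtinian_of_tower k hart, hfin⟩

end Endomorphisms

end ADR

theorem theorem1p1 {A : Type u} [Ring A] (hA : ADR.IsArtinAlgebra A)
    {M : Type v} [AddCommGroup M] [Module Aᵐᵒᵖ M] [Module.Finite Aᵐᵒᵖ M]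
    (hM : ADR.IsSemilocalModule Aᵐᵒᵖ M)
    {T : Type w} [AddCommGroup T] [Module Aᵐᵒᵖ T] {ι : Type z} (X : ι → Submodule Aᵐᵒᵖ T)
    (hX : ADR.IsBasicModuleOf Aᵐᵒᵖ (ADR.LoewySum Aᵐᵒᵖ M) X) :
    ADR.IsLeftStronglyQuasiHereditary (Module.End Aᵐᵒᵖ T)
      (ADR.adrOrder X (ADR.loewyLength Aᵐᵒᵖ M)) (fun a => ADR.topHom (X a)) := by
  obtain ⟨k, _, _, _, _⟩ := hA
  have : Module.Finite k Aᵐᵒᵖ := Module.Finite.equiv (MulOpposite.opLinearEquiv k)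
  have : IsArtinianRing Aᵐᵒᵖ := isArtinian_of_tower k inferInstance
  obtain ⟨_, h⟩ := hX.structure_of_isSemilocal hM
  have hfin : ∀ a, Module.Finite Aᵐᵒᵖ (X a) := fun a => (h a).1
  have : Module.Finite Aᵐᵒᵖ T := by
    rw [Module.finite_def, ← hX.iSup_eq_top]
    exact Submodule.fg_iSup _ fun a => Module.Finite.iff_fg.1 (hfin a)
  obtain ⟨k', _, _, _, _⟩ := ADR.exists_artinian_finite_end (R := Aᵐᵒᵖ) (T := T) (k := k)
  exact ADR.isLeftStronglyQuasiHereditary_end (k := k') hX.indep hX.iSup_eq_top hfin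
    hX.indecomposable hX.not_iso (fun a => (h a).2.1) (fun a => (h a).2.2.1)
    fun a => (h a).2.2.2
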